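/- Let $\mathfrak g$ be a finite-dimensional complex Lie algebra, $\mathfrak l\subset\mathfrak g$ a Lie subalgebra with basis $x_1,\dots,x_n$, and $\Omega\in(S^2\mathfrak g)^{\mathfrak g}$. Assume condition i): $\mathfrak l$ has an $\mathfrak l$-invariant complement $\mathfrak m$ in $\mathfrak g$, which is fixed. **Formal functions.** Let $D$ be the formal neighbourhood of $0$ in $\mathfrak l^*$; functions $D\to V$ are elements of $V[[x_1,\dots,x_n]]$, elements of $\mathfrak l$ being viewed as linear functions on $\mathfrak l^*$. For a $\mathfrak g$-module $V$, a function $f:D\to V$ is $\mathfrak l$-equivariant if $y\cdot f=\sum_i[x_i,y]\,\partial_i f$ for all $y\in\mathfrak l$ (equivariance for the coadjoint action on $\mathfrak l^*$). **Dynamical r-matrices.** Put $CYB(r)=[r^{12},r^{13}]+[r^{12},r^{23}]+[r^{13},r^{23}]$, $\overline{dr}=\sum_i x_i\otimes\partial_i r$ and $\mathrm{Alt}(x)=x^{123}-x^{213}+x^{312}$, so that $\mathrm{Alt}(a\otimes b\otimes c)=a\otimes b\otimes c-b\otimes a\otimes c+b\otimes c\otimes a$. Let $Dynr(\mathfrak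 g,\mathfrak l,\Omega)$ be the set of $\mathfrak l$-equivariant $r:D\to\mathfrak g\otimes\mathfrak g$ with $$\mathrm{Alt}(\overline{dr})+CYB(r)=0,\qquad r+r^{21}=\Omega .$$ **Gauge transformations.** Let $G$ be the simply connected complex Lie group with Lie algebra $\mathfrak g$, and let $\mathrm{Map}_0(D,G)^{\mathfrak l}$ be the group of $\mathfrak l$-equivariant formal maps $g:D\to G$ with $g(0)=1$; these are the $g=e^{\chi}$ with $\chi:D\to\mathfrak g$ an $\mathfrak l$-equivariant formal function with $\chi(0)=0$. For such $g$ let $\eta_i=g^{-1}\partial_i g=\sum_{k\ge0}\frac{(-1)^k}{(k+1)!}(\mathrm{ad}\,\chi)^k(\partial_i\chi)$, $\overline{\eta_g}=\sum_i x_i\otimes\eta_i$ and $$r^g=(g\otimes g)\Big(r-\overline{\eta_g}+\overline{\eta_g}^{21}-\sum_{i,j}[x_i,x_j]\,\eta_i\otimes\eta_j\Big)(g^{-1}\otimes g^{-1}),$$ where $[x_i,x_j]\in\mathfrak l$ is regarded as a linear function on $D$ and $(g\otimes g)(\cdot)(g^{-1}\otimes g^{-1})=e^{\mathrm{ad}\,\chi}$.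 Let $\mathcal M(\mathfrak g,\mathfrak l,\Omega)=Dynr(\mathfrak g,\mathfrak l,\Omega)/\mathrm{Map}_0(D,G)^{\mathfrak l}$ be the set of gauge classes. Finally, let $$\mathcal M_\Omega=\Big\{x\in\tfrac{\Omega}{2}+(\Lambda^2\mathfrak m)^{\mathfrak l}\ \Big|\ CYB(x)=0\text{ in }\Lambda^3(\mathfrak g/\mathfrak l)\Big\}.$$ **Corollary 3.1.** Every gauge class in $\mathcal M(\mathfrak g,\mathfrak l,\Omega)$ has a representative $r$ with $r(0)\in\frac{\Omega}{2}+\Lambda^2\mathfrak m$. Sending the class to $r(0)$, where $r$ is any such representative, is a well-defined injective map $\mathcal M(\mathfrak g,\mathfrak l,\Omega)\to\mathcal M_\Omega$. -/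

import Mathlib

open scoped TensorProduct

noncomputable section

namespace DynR

/-! ### Formal functions on the formal neighbourhood `D` of `0` in the dual of `𝔩` -/

/-- `V[[x₁,…,xₙ]]`: formal functions on `D` with values in `V`, given by their coefficients.
The coefficient of the monomial `x^d` is `f d`; in particular `f(0)` is `f 0`. -/
abbrev FormalFun (n : ℕ) (V : Type*) : Type _ := (Fin n →₀ ℕ) → V

section Formal

variable {n : ℕ} {U V W : Type*}
variable [AddCommGroup U] [Module ℂ U] [AddCommGroup V] [Module ℂ V] [AddCommGroup W] [Module ℂ W]

/-- The constant function with value `v`. -/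
def const (n : ℕ) (v : V) : FormalFun n V := Pi.single 0 v

/-- The (Cauchy) product of two formal functions along a bilinear map of the values. -/
def cprod (B : U →ₗ[ℂ] V →ₗ[ℂ] W) (f : FormalFun n U) (g : FormalFun n V) : FormalFun n W :=
  fun d => ∑ p ∈ Finset.HasAntidiagonal.antidiagonal d, B (f p.1) (g p.2)

/-- Apply a linear map to the values. -/
def mapVal (L : V →ₗ[ℂ] W) (f : FormalFun n V) : FormalFun n W := fun d => L (f d)

/-- The formal partial derivative `∂f/∂xᵢ`. -/
def pderiv (i : Fin n) (f : FormalFun n V) : FormalFun n V :=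
  fun d => ((d i : ℂ) + 1) • f (d + Finsupp.single i 1)

end Formal

/-! ### Tensors -/

section Tensors

variable (𝔤 : Type*) [LieRing 𝔤] [LieAlgebra ℂ 𝔤]

/-- The bracket as a bilinear map `𝔤 → 𝔤 → 𝔤`. -/
def brk : 𝔤 →ₗ[ℂ] 𝔤 →ₗ[ℂ] 𝔤 := (LieModule.toEnd ℂ 𝔤 𝔤 : 𝔤 →ₗ[ℂ] Module.End ℂ 𝔤)

/-- `(a, b) ↦ [a¹², b¹³]`. -/
def br1213 : (𝔤 ⊗[ℂ] 𝔤) →ₗ[ℂ] (𝔤 ⊗[ℂ] 𝔤) →ₗ[ℂ] (𝔤 ⊗[ℂ] (𝔤 ⊗[ℂ] 𝔤)) :=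
  TensorProduct.map₂ (brk 𝔤) (TensorProduct.mk ℂ 𝔤 𝔤)

/-- `(a, b) ↦ [a¹², b²³]`. -/
def br1223 : (𝔤 ⊗[ℂ] 𝔤) →ₗ[ℂ] (𝔤 ⊗[ℂ] 𝔤) →ₗ[ℂ] (𝔤 ⊗[ℂ] (𝔤 ⊗[ℂ] 𝔤)) :=
  (LinearMap.lTensorHom 𝔤 ∘ₗ (LinearMap.rTensorHom 𝔤 ∘ₗ brk 𝔤).flip).flip

/-- `(a, b) ↦ [a¹³, b²³]`. -/
def br1323 : (𝔤 ⊗[ℂ] 𝔤) →ₗ[ℂ] (𝔤 ⊗[ℂ] 𝔤) →ₗ[ℂ] (𝔤 ⊗[ℂ] (𝔤 ⊗[ℂ] 𝔤)) :=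
  (TensorProduct.map₂ (TensorProduct.mk ℂ 𝔤 𝔤) (brk 𝔤)).compr₂
    (TensorProduct.assoc ℂ 𝔤 𝔤 𝔤).toLinearMap

variable {𝔤}

theorem br1213_tmul (a₁ a₂ b₁ b₂ : 𝔤) :
    br1213 𝔤 (a₁ ⊗ₜ a₂) (b₁ ⊗ₜ b₂) = ⁅a₁, b₁⁆ ⊗ₜ (a₂ ⊗ₜ b₂) := rfl

theorem br1223_tmul (a₁ a₂ b₁ b₂ : 𝔤) :
    br1223 𝔤 (a₁ ⊗ₜ a₂) (b₁ ⊗ₜ b₂) = a₁ ⊗ₜ (⁅a₂, b₁⁆ ⊗ₜ b₂) := rfl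

theorem br1323_tmul (a₁ a₂ b₁ b₂ : 𝔤) :
    br1323 𝔤 (a₁ ⊗ₜ a₂) (b₁ ⊗ₜ b₂) = a₁ ⊗ₜ (b₁ ⊗ₜ ⁅a₂, b₂⁆) := rfl

/-- The classical Yang–Baxter operator `[r¹²,r¹³] + [r¹²,r²³] + [r¹³,r²³]` on `𝔤 ⊗ 𝔤`. -/
def CYB (r : 𝔤 ⊗[ℂ] 𝔤) : 𝔤 ⊗[ℂ] (𝔤 ⊗[ℂ] 𝔤) := br1213 𝔤 r r + br1223 𝔤 r r + br1323 𝔤 r r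

/-- The classical Yang–Baxter operator on formal functions with values in `𝔤 ⊗ 𝔤`. -/
def CYBFun {n : ℕ} (r : FormalFun n (𝔤 ⊗[ℂ] 𝔤)) : FormalFun n (𝔤 ⊗[ℂ] (𝔤 ⊗[ℂ] 𝔤)) :=
  cprod (br1213 𝔤) r r + cprod (br1223 𝔤) r r + cprod (br1323 𝔤) r r

variable (𝔤) in
/-- The flip `a ⊗ b ↦ b ⊗ a`, i.e. `r ↦ r²¹`. -/
def flip21 : 𝔤 ⊗[ℂ] 𝔤 →ₗ[ℂ] 𝔤 ⊗[ℂ] 𝔤 := (TensorProduct.comm ℂ 𝔤 𝔤).toLinearMap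

variable (𝔤) in
/-- `Alt(x) = x¹²³ - x²¹³ + x³¹²`. For `x = a ⊗ b ⊗ c`, `x²¹³ = b ⊗ a ⊗ c` (`a` is put in
position 2, `b` in position 1) and `x³¹² = b ⊗ c ⊗ a` (`a` is put in position 3, `b` in position 1,
`c` in position 2). -/
def Alt : (𝔤 ⊗[ℂ] (𝔤 ⊗[ℂ] 𝔤)) →ₗ[ℂ] (𝔤 ⊗[ℂ] (𝔤 ⊗[ℂ] 𝔤)) :=
  LinearMap.id - (TensorProduct.leftComm ℂ 𝔤 𝔤 𝔤).toLinearMap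
    + (TensorProduct.assoc ℂ 𝔤 𝔤 𝔤).toLinearMap
        ∘ₗ (TensorProduct.comm ℂ 𝔤 (𝔤 ⊗[ℂ] 𝔤)).toLinearMap

theorem Alt_tmul (a b c : 𝔤) :
    Alt 𝔤 (a ⊗ₜ (b ⊗ₜ c)) = a ⊗ₜ (b ⊗ₜ c) - b ⊗ₜ (a ⊗ₜ c) + b ⊗ₜ (c ⊗ₜ a) := rfl

/-- `Λ²𝔪 ⊂ 𝔤 ⊗ 𝔤`, as the space of antisymmetric tensors in `𝔪 ⊗ 𝔪`. -/
def wedge2 (𝔪 : Submodule ℂ 𝔤) : Submodule ℂ (𝔤 ⊗[ℂ] 𝔤) :=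
  LinearMap.range (TensorProduct.map 𝔪.subtype 𝔪.subtype) ⊓
    LinearMap.ker (LinearMap.id + flip21 𝔤)

end Tensors

/-! ### Equivariance, dynamical r-matrices -/

section Dynamical

variable {𝔤 : Type*} [LieRing 𝔤] [LieAlgebra ℂ 𝔤] {𝔩 : LieSubalgebra ℂ 𝔤} {n : ℕ}
variable (b : Module.Basis (Fin n) ℂ 𝔩)

/-- The element `y` of `𝔩`, regarded as a linear function on the dual of `𝔩`; its expansion is
`∑ i, yᵢ xᵢ`, where the basis vector `b i` is the coordinate `xᵢ`. -/
def linFun (y : 𝔩) : FormalFun n ℂ := ∑ i, Pi.single (Finsupp.single i 1) (b.repr y i)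

/-- The product of the linear function `y ∈ 𝔩` with a formal function. -/
def mulLin {V : Type*} [AddCommGroup V] [Module ℂ V] (y : 𝔩) (f : FormalFun n V) :
    FormalFun n V :=
  cprod (LinearMap.lsmul ℂ V) (linFun b y) f

/-- `𝔩`-equivariance of `f : D → V`, for the coadjoint action of `𝔩` on `D` and the action on `V`.
As `(ad*_y λ)(x) = -λ([y, x])`, the condition is `y · f = ∑ i, [xᵢ, y] ∂ᵢ f` for all `y ∈ 𝔩`, with
`[xᵢ, y] ∈ 𝔩` regarded as a linear function on `D`. -/
def IsEquivariant {V : Type*} [AddCommGroup V] [Module ℂ V] [LieRingModule 𝔤 V] [LieModule ℂ 𝔤 V]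
    (f : FormalFun n V) : Prop :=
  ∀ y : 𝔩, mapVal (LieModule.toEnd ℂ 𝔤 V (y : 𝔤)) f = ∑ i, mulLin b ⁅b i, y⁆ (pderiv i f)

/-- `Alt` of `d r`, where `d r = ∑ i, xᵢ ⊗ ∂ᵢ r` is regarded as a function with values in
`𝔩 ⊗ (𝔤 ⊗ 𝔤) ⊂ 𝔤 ⊗ 𝔤 ⊗ 𝔤`. -/
def altD (r : FormalFun n (𝔤 ⊗[ℂ] 𝔤)) : FormalFun n (𝔤 ⊗[ℂ] (𝔤 ⊗[ℂ] 𝔤)) :=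
  mapVal (Alt 𝔤) (∑ i, mapVal (TensorProduct.mk ℂ 𝔤 (𝔤 ⊗[ℂ] 𝔤) (b i : 𝔤)) (pderiv i r))

/-- A dynamical r-matrix: an `𝔩`-equivariant solution of the classical dynamical Yang–Baxter
equation `Alt(dr) + CYB(r) = 0` which satisfies `r + r²¹ = Ω`. -/
structure IsDynR (Ω : 𝔤 ⊗[ℂ] 𝔤) (r : FormalFun n (𝔤 ⊗[ℂ] 𝔤)) : Prop where
  equivariant : IsEquivariant b r
  cdybe : altD b r + CYBFun r = 0
  quasiUnitary : r + mapVal (flip21 𝔤) r = const n Ω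

/-- The set `Dynr(𝔤, 𝔩, Ω)`. -/
def Dynr (Ω : 𝔤 ⊗[ℂ] 𝔤) : Type _ := {r : FormalFun n (𝔤 ⊗[ℂ] 𝔤) // IsDynR b Ω r}

end Dynamical

/-! ### Gauge transformations

A formal map `g : D → G` with `g(0) = 1` is the same as `g = e^χ` for a formal function
`χ : D → 𝔤` with `χ(0) = 0`, since `exp : 𝔤 → G` is a local isomorphism at `0`; it is equivariant
if and only if `χ` is. One has `Ad(e^χ) = e^{ad χ}` and, for the components of `η_g = g⁻¹ dg`,
`g⁻¹ ∂ᵢ g = ∑ k, (-1)^k / (k+1)! (ad χ)^k (∂ᵢ χ)`. -/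

section Gauge

variable {𝔤 : Type*} [LieRing 𝔤] [LieAlgebra ℂ 𝔤] {n : ℕ}

/-- The pointwise action of `χ : D → 𝔤` on functions with values in a `𝔤`-module `V`. -/
def act {V : Type*} [AddCommGroup V] [Module ℂ V] [LieRingModule 𝔤 V] [LieModule ℂ 𝔤 V]
    (χ : FormalFun n 𝔤) (f : FormalFun n V) : FormalFun n V :=
  cprod (LieModule.toEnd ℂ 𝔤 V : 𝔤 →ₗ[ℂ] Module.End ℂ V) χ f

/-- If `χ(0) = 0`, the `k`-th iterate of the action of `χ` vanishes in degrees below `k`. Hence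
the series below are finite sums in each degree. -/
theorem act_iterate_eq_zero {V : Type*} [AddCommGroup V] [Module ℂ V] [LieRingModule 𝔤 V]
    [LieModule ℂ 𝔤 V] (χ : FormalFun n 𝔤) (hχ : χ 0 = 0) (f : FormalFun n V) (k : ℕ)
    (d : Fin n →₀ ℕ) (hd : d.degree < k) : (act χ)^[k] f d = 0 := by
  induction k generalizing d with
  | zero => omega
  | succ k ih =>
    rw [Function.iterate_succ_apply']
    refine Finset.sum_eq_zero fun p hp => ?_
    have hp' : p.1 + p.2 = d := Finset.HasAntidiagonal.mem_antidiagonal.mp hp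
    by_cases h : p.1 = 0
    · simp [h, hχ]
    · have h1 : p.1.degree ≠ 0 := by simpa [Finsupp.degree_eq_zero_iff] using h
      have h2 : p.1.degree + p.2.degree = d.degree := by rw [← hp', map_add]
      rw [ih p.2 (by omega), map_zero]

/-- `∑ k, c k (ad χ)^k f` for `χ(0) = 0`: the coefficient of `x^d` only receives the terms with
`k ≤ |d|`. -/
def adSeries {V : Type*} [AddCommGroup V] [Module ℂ V] [LieRingModule 𝔤 V] [LieModule ℂ 𝔤 V]
    (c : ℕ → ℂ) (χ : FormalFun n 𝔤) (f : FormalFun n V) : FormalFun n V :=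
  fun d => ∑ k ∈ Finset.range (d.degree + 1), c k • (act χ)^[k] f d

/-- The action of `g = e^χ` on functions with values in `V`; for `V = 𝔤 ⊗ 𝔤` it is
`f ↦ (g ⊗ g) f (g⁻¹ ⊗ g⁻¹)`. -/
def expAct {V : Type*} [AddCommGroup V] [Module ℂ V] [LieRingModule 𝔤 V] [LieModule ℂ 𝔤 V]
    (χ : FormalFun n 𝔤) (f : FormalFun n V) : FormalFun n V :=
  adSeries (fun k => ((k.factorial : ℂ))⁻¹) χ f

/-- The component `g⁻¹ ∂ᵢ g` of `η_g = g⁻¹ dg`, for `g = e^χ`. -/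
def etaComp (χ : FormalFun n 𝔤) (i : Fin n) : FormalFun n 𝔤 :=
  adSeries (fun k => (-1) ^ k * (((k + 1).factorial : ℂ))⁻¹) χ (pderiv i χ)

variable {𝔩 : LieSubalgebra ℂ 𝔤} (b : Module.Basis (Fin n) ℂ 𝔩)

/-- `η_g` as a function with values in `𝔩 ⊗ 𝔤 ⊂ 𝔤 ⊗ 𝔤`: `∑ i, xᵢ ⊗ g⁻¹ ∂ᵢ g`. -/
def etaBar (χ : FormalFun n 𝔤) : FormalFun n (𝔤 ⊗[ℂ] 𝔤) :=
  ∑ i, mapVal (TensorProduct.mk ℂ 𝔤 𝔤 (b i : 𝔤)) (etaComp χ i)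

/-- `∑ i j, λ([xᵢ, xⱼ]) (g⁻¹ ∂ᵢ g) ⊗ (g⁻¹ ∂ⱼ g)`, that is, `(λ ⊗ 1 ⊗ 1) [η_g¹², η_g¹³]`. -/
def zetaContr (χ : FormalFun n 𝔤) : FormalFun n (𝔤 ⊗[ℂ] 𝔤) :=
  ∑ i, ∑ j, mulLin b ⁅b i, b j⁆ (cprod (TensorProduct.mk ℂ 𝔤 𝔤) (etaComp χ i) (etaComp χ j))

/-- The gauge transform
`r^g = (g ⊗ g) (r - η_g + η_g²¹ - (λ ⊗ 1 ⊗ 1) [η_g¹², η_g¹³]) (g⁻¹ ⊗ g⁻¹)` for `g = e^χ`. -/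
def gaugeTransform (χ : FormalFun n 𝔤) (r : FormalFun n (𝔤 ⊗[ℂ] 𝔤)) : FormalFun n (𝔤 ⊗[ℂ] 𝔤) :=
  expAct χ (r - etaBar b χ + mapVal (flip21 𝔤) (etaBar b χ) - zetaContr b χ)

/-- `r'` is the gauge transform of `r` by an equivariant `g : D → G` with `g(0) = 1`. -/
def GaugeRel (Ω : 𝔤 ⊗[ℂ] 𝔤) (r r' : Dynr b Ω) : Prop :=
  ∃ χ : FormalFun n 𝔤, χ 0 = 0 ∧ IsEquivariant b χ ∧ r'.1 = gaugeTransform b χ r.1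

/-- The moduli space `𝓜(𝔤, 𝔩, Ω)`: the quotient of `Dynr(𝔤, 𝔩, Ω)` by the equivalence relation
generated by gauge transformations with `g(0) = 1`, i.e. by the group generated by the `e^χ`
(equivariant `χ` with `χ(0) = 0`), which is the group of all equivariant `g` with `g(0) = 1`. -/
def Moduli (Ω : 𝔤 ⊗[ℂ] 𝔤) : Type _ := Quot (GaugeRel b Ω)

/-- The gauge class of a dynamical r-matrix. -/
def gaugeClass {Ω : 𝔤 ⊗[ℂ] 𝔤} (r : Dynr b Ω) : Moduli b Ω := Quot.mk _ r

end Gauge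

/-- `𝓜_Ω`: the elements `x` of `Ω/2 + (Λ²𝔪)^𝔩` for which `CYB(x)` vanishes in
`Λ³(𝔤/𝔩) ⊂ (𝔤/𝔩)^{⊗3}`. -/
def MOmega {𝔤 : Type*} [LieRing 𝔤] [LieAlgebra ℂ 𝔤] (𝔩 : LieSubalgebra ℂ 𝔤) (𝔪 : Submodule ℂ 𝔤)
    (Ω : 𝔤 ⊗[ℂ] 𝔤) : Set (𝔤 ⊗[ℂ] 𝔤) :=
  {x | (∃ t ∈ wedge2 𝔪, (∀ y ∈ 𝔩, ⁅y, t⁆ = 0) ∧ x = (1 / 2 : ℂ) • Ω + t) ∧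
    TensorProduct.map 𝔩.toSubmodule.mkQ
      (TensorProduct.map 𝔩.toSubmodule.mkQ 𝔩.toSubmodule.mkQ) (CYB x) = 0}

end DynR

end

/-! Let s(χ), called `gaugeShift`, be `∑ xᵢ ⊗ ∂ᵢχ` minus its flip. For equivariant χ with χ(0) = 0,
the curve R(t) of gauge transforms of r by e^{tχ} satisfies R' = χ·R - s(χ)
(`hasCoeffDeriv_gaugeTransform`). As χ(0) = 0, the action of χ raises degrees, so E' = χ·E and E(0)
= 0 force E = 0, degree by degree (`HasCoeffDeriv.eq_zero`). The failures of R(t) to be equivariant,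
to satisfy r + r²¹ = Ω and to solve the dynamical Yang–Baxter equation all obey such a linear
equation, so gauge transformations preserve dynamical r-matrices (`IsDynR.gaugeTransform`).

In lowest degree a change of χ by δ changes the gauge transform by -s(δ) (`gaugeTransform_eqMod`),
and Alt(d s(χ)) = 0. Let P be the projection to 𝔩 along 𝔪. Contraction with the Euler field along P
gives a Cartan formula (`gaugeShift_eulerContr`): for an antisymmetric closed function, s of the
contraction multiplies the 𝔩⊗𝔩, mixed and 𝔪⊗𝔪 components in degree k by k+2, k+1 and k. Hence s can
be inverted equivariantly on closed functions, except on Λ²𝔪 in degree 0 (`gaugeShift_homotopy`).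

In degree 0 this inversion moves r(0) into Ω/2 + Λ²𝔪 (`exists_gaugeTransform_normal`). Since s(χ)(0)
has no component in 𝔪⊗𝔪, that component of r(0) - Ω/2 is an invariant of the class: the map is well
defined. If two r-matrices agree at 0, the lowest term of their difference is closed, because the
quadratic terms contain no derivatives; removing it degree by degree gives a convergent χ
(`exists_gaugeTransform_eq`), which is injectivity. Equivariance and the equation at the origin
modulo 𝔩 place r(0) in `MOmega`. -/

noncomputable section

namespace DynR

open Finset.HasAntidiagonal (antidiagonal mem_antidiagonal)

/-! ### Calculus of formal functions -/

section Calculus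

variable {n : ℕ} {U V W X Y Z : Type*}
variable [AddCommGroup U] [Module ℂ U] [AddCommGroup V] [Module ℂ V] [AddCommGroup W] [Module ℂ W]
variable [AddCommGroup X] [Module ℂ X] [AddCommGroup Y] [Module ℂ Y] [AddCommGroup Z] [Module ℂ Z]

/-- `mapVal` as a linear map. -/
def mapValHom (L : V →ₗ[ℂ] W) : FormalFun n V →ₗ[ℂ] FormalFun n W where
  toFun := mapVal L
  map_add' f g := by ext d; simp [mapVal]
  map_smul' c f := by ext d; simp [mapVal]

/-- `pderiv` as a linear map. -/
def pderivHom (i : Fin n) : FormalFun n V →ₗ[ℂ] FormalFun n V where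
  toFun := pderiv i
  map_add' f g := by ext d; simp [pderiv]
  map_smul' c f := by ext d; simp [pderiv, smul_comm c]

/-- `cprod` as a bilinear map. -/
def cprodHom (B : U →ₗ[ℂ] V →ₗ[ℂ] W) : FormalFun n U →ₗ[ℂ] FormalFun n V →ₗ[ℂ] FormalFun n W :=
  LinearMap.mk₂ ℂ (cprod B)
    (fun f g h => by ext d; simp [cprod, Finset.sum_add_distrib])
    (fun c f g => by ext d; simp [cprod, Finset.smul_sum])
    (fun f g h => by ext d; simp [cprod, Finset.sum_add_distrib])
    (fun c f g => by ext d; simp [cprod, Finset.smul_sum])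

theorem mapVal_apply (L : V →ₗ[ℂ] W) (f : FormalFun n V) (d) : mapVal L f d = L (f d) := rfl

theorem mapVal_add (L : V →ₗ[ℂ] W) (f g : FormalFun n V) :
    mapVal L (f + g) = mapVal L f + mapVal L g := map_add (mapValHom L) f g
theorem mapVal_sub (L : V →ₗ[ℂ] W) (f g : FormalFun n V) :
    mapVal L (f - g) = mapVal L f - mapVal L g := map_sub (mapValHom L) f g
theorem mapVal_neg (L : V →ₗ[ℂ] W) (f : FormalFun n V) :
    mapVal L (-f) = -mapVal L f := map_neg (mapValHom L) f
theorem mapVal_smul (L : V →ₗ[ℂ] W) (c : ℂ) (f : FormalFun n V) :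
    mapVal L (c • f) = c • mapVal L f := map_smul (mapValHom L) c f
theorem mapVal_sum {ι : Type*} (s : Finset ι) (L : V →ₗ[ℂ] W) (f : ι → FormalFun n V) :
    mapVal L (∑ i ∈ s, f i) = ∑ i ∈ s, mapVal L (f i) := map_sum (mapValHom L) f s
theorem mapVal_zero (L : V →ₗ[ℂ] W) : mapVal L (0 : FormalFun n V) = 0 := map_zero (mapValHom L)

theorem pderiv_add (i : Fin n) (f g : FormalFun n V) :
    pderiv i (f + g) = pderiv i f + pderiv i g := map_add (pderivHom i) f g
theorem pderiv_sub (i : Fin n) (f g : FormalFun n V) :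
    pderiv i (f - g) = pderiv i f - pderiv i g := map_sub (pderivHom i) f g
theorem pderiv_smul (i : Fin n) (c : ℂ) (f : FormalFun n V) :
    pderiv i (c • f) = c • pderiv i f := map_smul (pderivHom i) c f
theorem pderiv_sum {ι : Type*} (s : Finset ι) (i : Fin n) (f : ι → FormalFun n V) :
    pderiv i (∑ j ∈ s, f j) = ∑ j ∈ s, pderiv i (f j) := map_sum (pderivHom i) f s
theorem pderiv_zero (i : Fin n) : pderiv i (0 : FormalFun n V) = 0 := map_zero (pderivHom i)
theorem pderiv_mapVal (i : Fin n) (L : V →ₗ[ℂ] W) (f : FormalFun n V) :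
    pderiv i (mapVal L f) = mapVal L (pderiv i f) := by
  ext d; simp [pderiv, mapVal]

theorem pderiv_comm (i j : Fin n) (f : FormalFun n V) :
    pderiv i (pderiv j f) = pderiv j (pderiv i f) := by
  ext d
  by_cases h : i = j
  · rw [h]
  · simp [pderiv, smul_smul, h, Ne.symm h, add_right_comm, mul_comm]

theorem pderiv_const (i : Fin n) (v : V) : pderiv i (const n v) = 0 := by
  ext d
  have : d + Finsupp.single i 1 ≠ 0 := fun h => by
    simpa using DFunLike.congr_fun h i
  simp [pderiv, const, this]

theorem mapVal_const (L : V →ₗ[ℂ] W) (v : V) : mapVal L (const n v) = const n (L v) := by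
  ext d
  by_cases h : d = 0
  · simp [mapVal, const, h]
  · simp [mapVal, const, h]

section
variable (B : U →ₗ[ℂ] V →ₗ[ℂ] W)

theorem cprod_add_left (f g : FormalFun n U) (h : FormalFun n V) :
    cprod B (f + g) h = cprod B f h + cprod B g h := (cprodHom B).map_add₂ f g h
theorem cprod_sub_left (f g : FormalFun n U) (h : FormalFun n V) :
    cprod B (f - g) h = cprod B f h - cprod B g h := (cprodHom B).map_sub₂ f g h
theorem cprod_smul_left (c : ℂ) (f : FormalFun n U) (h : FormalFun n V) :
    cprod B (c • f) h = c • cprod B f h := (cprodHom B).map_smul₂ c f h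
theorem cprod_sum_left {ι : Type*} (s : Finset ι) (f : ι → FormalFun n U) (h : FormalFun n V) :
    cprod B (∑ i ∈ s, f i) h = ∑ i ∈ s, cprod B (f i) h := (cprodHom B).map_sum₂ s f h
theorem cprod_neg_left (f : FormalFun n U) (h : FormalFun n V) :
    cprod B (-f) h = -cprod B f h := (cprodHom B).map_neg₂ f h
theorem cprod_zero_left (h : FormalFun n V) : cprod B (0 : FormalFun n U) h = 0 :=
  (cprodHom B).map_zero₂ h
theorem cprod_add (f : FormalFun n U) (g h : FormalFun n V) :
    cprod B f (g + h) = cprod B f g + cprod B f h := map_add (cprodHom B f) g h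
theorem cprod_sub (f : FormalFun n U) (g h : FormalFun n V) :
    cprod B f (g - h) = cprod B f g - cprod B f h := map_sub (cprodHom B f) g h
theorem cprod_smul (c : ℂ) (f : FormalFun n U) (h : FormalFun n V) :
    cprod B f (c • h) = c • cprod B f h := map_smul (cprodHom B f) c h
theorem cprod_sum {ι : Type*} (s : Finset ι) (f : FormalFun n U) (h : ι → FormalFun n V) :
    cprod B f (∑ i ∈ s, h i) = ∑ i ∈ s, cprod B f (h i) := map_sum (cprodHom B f) h s
theorem cprod_zero (f : FormalFun n U) : cprod B f (0 : FormalFun n V) = 0 :=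
  map_zero (cprodHom B f)

theorem cprod_flip (f : FormalFun n U) (g : FormalFun n V) :
    cprod B f g = cprod B.flip g f := by
  ext d
  exact Finsupp.sum_antidiagonal_swap d fun a c => B (f a) (g c)

theorem mapVal_cprod (L : W →ₗ[ℂ] X) (f : FormalFun n U) (g : FormalFun n V) :
    mapVal L (cprod B f g) = cprod (B.compr₂ L) f g := by
  ext d; simp [mapVal, cprod]

theorem cprod_const_left (u : U) (g : FormalFun n V) :
    cprod B (const n u) g = mapVal (B u) g := by
  ext d
  rw [cprod, Finset.sum_eq_single (0, d)]
  · simp [const, mapVal]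
  · rintro ⟨p, q⟩ hp hne
    have hp' : p + q = d := mem_antidiagonal.mp hp
    have : p ≠ 0 := by
      rintro rfl
      exact hne (by rw [← hp', zero_add])
    simp [const, this]
  · intro h
    exact absurd (mem_antidiagonal.mpr (zero_add d)) h

theorem cprod_const (f : FormalFun n U) (v : V) :
    cprod B f (const n v) = mapVal (B.flip v) f := by
  rw [cprod_flip, cprod_const_left]

theorem cprod_apply_zero (f : FormalFun n U) (g : FormalFun n V) :
    cprod B f g 0 = B (f 0) (g 0) := by
  simp [cprod]

end

theorem cprod_cprod_apply (A : U →ₗ[ℂ] V →ₗ[ℂ] W) (B : X →ₗ[ℂ] Y →ₗ[ℂ] V) (f : FormalFun n U)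
    (g : FormalFun n X) (h : FormalFun n Y) (d) :
    cprod A f (cprod B g h) d = ∑ p ∈ antidiagonal d,
      ∑ s ∈ antidiagonal p.2, A (f p.1) (B (g s.1) (h s.2)) := by
  simp [cprod]

theorem sum_antidiagonal_assoc {M : Type*} [AddCommMonoid M]
    (d : Fin n →₀ ℕ) (F : (Fin n →₀ ℕ) → (Fin n →₀ ℕ) → (Fin n →₀ ℕ) → M) :
    ∑ p ∈ antidiagonal d,
      ∑ s ∈ antidiagonal p.2, F p.1 s.1 s.2 =
    ∑ p ∈ antidiagonal d,
      ∑ s ∈ antidiagonal p.1, F s.1 s.2 p.2 := by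
  classical
  simp only [Finset.sum_sigma']
  apply Finset.sum_nbij' (fun ⟨⟨i, _⟩, ⟨k, l⟩⟩ ↦ ⟨(i + k, l), (i, k)⟩)
    (fun ⟨⟨_, j⟩, ⟨k, l⟩⟩ ↦ ⟨(k, l + j), (l, j)⟩) <;>
  simp +contextual [add_assoc]
  rintro _ rfl h
  rw [← h, add_assoc]

theorem sum_antidiagonal_left_comm {M : Type*} [AddCommMonoid M]
    (d : Fin n →₀ ℕ) (F : (Fin n →₀ ℕ) → (Fin n →₀ ℕ) → (Fin n →₀ ℕ) → M) :
    ∑ p ∈ antidiagonal d, ∑ s ∈ antidiagonal p.2, F p.1 s.1 s.2 =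
    ∑ p ∈ antidiagonal d, ∑ s ∈ antidiagonal p.2, F s.1 p.1 s.2 := by
  rw [sum_antidiagonal_assoc, sum_antidiagonal_assoc d fun a c e => F c a e]
  exact Finset.sum_congr rfl fun p _ => Finsupp.sum_antidiagonal_swap p.1 fun a c => F a c p.2

/-- If `A` acts as a derivation of the product `B`, so does it on formal functions. -/
theorem cprod_derivation {X' Y' : Type*}
    [AddCommGroup X'] [Module ℂ X'] [AddCommGroup Y'] [Module ℂ Y']
    {A : U →ₗ[ℂ] V →ₗ[ℂ] W} {B : X →ₗ[ℂ] Y →ₗ[ℂ] V}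
    {C : X' →ₗ[ℂ] Y →ₗ[ℂ] W} {D : U →ₗ[ℂ] X →ₗ[ℂ] X'}
    {E : X →ₗ[ℂ] Y' →ₗ[ℂ] W} {F : U →ₗ[ℂ] Y →ₗ[ℂ] Y'}
    (hyp : ∀ u x y, A u (B x y) = C (D u x) y + E x (F u y))
    (f : FormalFun n U) (g : FormalFun n X) (h : FormalFun n Y) :
    cprod A f (cprod B g h) = cprod C (cprod D f g) h + cprod E g (cprod F f h) := by
  ext d
  have h1 : cprod C (cprod D f g) h d = ∑ p ∈ antidiagonal d, ∑ s ∈ antidiagonal p.2,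
      C (D (f p.1) (g s.1)) (h s.2) := by
    rw [sum_antidiagonal_assoc d fun a c e => C (D (f a) (g c)) (h e)]
    simp [cprod]
  rw [Pi.add_apply, h1, cprod_cprod_apply, cprod_cprod_apply,
    sum_antidiagonal_left_comm d fun a c e => E (g a) (F (f c) (h e))]
  simp [hyp, Finset.sum_add_distrib]

/-- Left commutativity of the Cauchy product. -/
theorem cprod_left_comm {A : U →ₗ[ℂ] V →ₗ[ℂ] W} {B : X →ₗ[ℂ] Y →ₗ[ℂ] V} {C : X →ₗ[ℂ] Z →ₗ[ℂ] W}
    {D : U →ₗ[ℂ] Y →ₗ[ℂ] Z} (hyp : ∀ u x y, A u (B x y) = C x (D u y)) (f : FormalFun n U)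
    (g : FormalFun n X) (h : FormalFun n Y) :
    cprod A f (cprod B g h) = cprod C g (cprod D f h) := by
  ext d
  rw [cprod_cprod_apply, cprod_cprod_apply,
    sum_antidiagonal_left_comm d fun a c e => C (g a) (D (f c) (h e))]
  simp [hyp]

/-- Shift of the first index by one; the pairs missed by the shift have i-th exponent 0 and are
killed by the coefficient. -/
theorem sum_antidiagonal_add_single (d : Fin n →₀ ℕ) (i : Fin n)
    (F : (Fin n →₀ ℕ) → (Fin n →₀ ℕ) → W) :
    ∑ p ∈ antidiagonal (d + Finsupp.single i 1), ((Prod.fst p : Fin n →₀ ℕ) i : ℂ) • F p.1 p.2 =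
    ∑ p ∈ antidiagonal d,
      ((p.1 i : ℂ) + 1) • F (p.1 + Finsupp.single i 1) p.2 := by
  symm
  refine Finset.sum_of_injOn (fun p => (p.1 + Finsupp.single i 1, p.2)) ?_ ?_ ?_ ?_
  · rintro ⟨a, c⟩ _ ⟨a', c'⟩ _ h
    simpa using h
  · rintro ⟨a, c⟩ h
    simp only [Finset.mem_coe, mem_antidiagonal] at h ⊢
    rw [← h, add_right_comm]
  · rintro ⟨a, c⟩ h hn
    rw [mem_antidiagonal] at h
    have : a i = 0 := by
      by_contra h0
      refine hn ⟨(a - Finsupp.single i 1, c), ?_, ?_⟩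
      · have hle : Finsupp.single i 1 ≤ a := by
          simpa [Finsupp.single_le_iff] using Nat.one_le_iff_ne_zero.mpr h0
        simp only [Finset.mem_coe, mem_antidiagonal] at h ⊢
        apply add_right_cancel (b := Finsupp.single i 1)
        rw [add_right_comm, tsub_add_cancel_of_le hle, h]
      · have hle : Finsupp.single i 1 ≤ a := by
          simpa [Finsupp.single_le_iff] using Nat.one_le_iff_ne_zero.mpr h0
        simp [tsub_add_cancel_of_le hle]
    simp [this]
  · rintro ⟨a, c⟩ _
    simp

theorem pderiv_cprod (B : U →ₗ[ℂ] V →ₗ[ℂ] W) (i : Fin n) (f : FormalFun n U)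
    (g : FormalFun n V) :
    pderiv i (cprod B f g) = cprod B (pderiv i f) g + cprod B f (pderiv i g) := by
  ext d
  have h1 := sum_antidiagonal_add_single d i fun a c => B (f a) (g c)
  have h2 := sum_antidiagonal_add_single d i fun a c => B (f c) (g a)
  rw [Finsupp.sum_antidiagonal_swap (d + Finsupp.single i 1)
      (fun a c => (a i : ℂ) • B (f c) (g a)),
    Finsupp.sum_antidiagonal_swap d
      (fun a c => ((a i : ℂ) + 1) • B (f c) (g (a + Finsupp.single i 1)))] at h2
  -- The factor `d i + 1` is the i-th exponent of the total degree, which splits between the two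
  -- factors of the product.
  have h3 : pderiv i (cprod B f g) d =
      ∑ p ∈ antidiagonal (d + Finsupp.single i 1),
        (((Prod.fst p : Fin n →₀ ℕ) i : ℂ) • B (f p.1) (g p.2) +
          ((Prod.snd p : Fin n →₀ ℕ) i : ℂ) • B (f p.1) (g p.2)) := by
    rw [pderiv, cprod, Finset.smul_sum]
    refine Finset.sum_congr rfl fun p hp => ?_
    rw [← add_smul]
    have := DFunLike.congr_fun (mem_antidiagonal.mp hp) i
    simp only [Finsupp.add_apply, Finsupp.single_eq_same] at this
    congr 1
    exact_mod_cast this.symm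
  rw [h3, Finset.sum_add_distrib, h1, h2]
  simp [cprod, pderiv]

end Calculus

/-! ### Curves of formal functions -/

section Curves

variable {n : ℕ} {U V W : Type*}
variable [AddCommGroup U] [Module ℂ U] [AddCommGroup V] [Module ℂ V] [AddCommGroup W] [Module ℂ W]

/-- The curve `F` of formal functions is coefficientwise differentiable, with derivative `F'`.
Differentiability of curves in `V` is tested on linear functionals. -/
def HasCoeffDeriv (F F' : ℂ → FormalFun n V) : Prop :=
  ∀ (t : ℂ) (d : Fin n →₀ ℕ) (φ : V →ₗ[ℂ] ℂ), HasDerivAt (fun s => φ (F s d)) (φ (F' t d)) t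

namespace HasCoeffDeriv

variable {F F' G G' : ℂ → FormalFun n V}

theorem congr (h : HasCoeffDeriv F F') (h' : ∀ t, F' t = G' t) : HasCoeffDeriv F G' := by
  intro t d φ; rw [← h']; exact h t d φ

theorem const (f : FormalFun n V) : HasCoeffDeriv (fun _ => f) (fun _ => 0) := by
  intro t d φ; simpa using hasDerivAt_const t (φ (f d))

theorem add (h : HasCoeffDeriv F F') (h' : HasCoeffDeriv G G') :
    HasCoeffDeriv (fun t => F t + G t) (fun t => F' t + G' t) := by
  intro t d φ; simpa using (h t d φ).fun_add (h' t d φ)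

theorem sub (h : HasCoeffDeriv F F') (h' : HasCoeffDeriv G G') :
    HasCoeffDeriv (fun t => F t - G t) (fun t => F' t - G' t) := by
  intro t d φ; simpa using (h t d φ).fun_sub (h' t d φ)

theorem sum {ι : Type*} {s : Finset ι} {F F' : ι → ℂ → FormalFun n V}
    (h : ∀ i ∈ s, HasCoeffDeriv (F i) (F' i)) :
    HasCoeffDeriv (fun t => ∑ i ∈ s, F i t) (fun t => ∑ i ∈ s, F' i t) := by
  intro t d φ
  simpa using HasDerivAt.fun_sum fun i hi => h i hi t d φ

theorem mapVal (L : V →ₗ[ℂ] W) (h : HasCoeffDeriv F F') :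
    HasCoeffDeriv (fun t => mapVal L (F t)) (fun t => DynR.mapVal L (F' t)) :=
  fun t d φ => h t d (φ ∘ₗ L)

theorem pderiv (i : Fin n) (h : HasCoeffDeriv F F') :
    HasCoeffDeriv (fun t => pderiv i (F t)) (fun t => DynR.pderiv i (F' t)) :=
  fun t d φ => by
    simpa [DynR.pderiv] using h t (d + Finsupp.single i 1) (((d i : ℂ) + 1) • φ)

/-- Derivatives are tested on linear functionals of each factor separately, while φ ∘ B is bilinear.
Finite dimension lets it be expanded in products of coordinates, where the scalar product rule
applies. -/
theorem cprod [FiniteDimensional ℂ U] [FiniteDimensional ℂ V] (B : U →ₗ[ℂ] V →ₗ[ℂ] W)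
    {F F' : ℂ → FormalFun n U} {G G' : ℂ → FormalFun n V} (h : HasCoeffDeriv F F')
    (h' : HasCoeffDeriv G G') :
    HasCoeffDeriv (fun t => cprod B (F t) (G t))
      (fun t => DynR.cprod B (F' t) (G t) + DynR.cprod B (F t) (G' t)) := by
  intro t d φ
  let bU := Module.finBasis ℂ U
  let bV := Module.finBasis ℂ V
  obtain ⟨κ, key⟩ : ∃ κ : _ → _ → ℂ, ∀ u v,
      φ (B u v) = ∑ i, ∑ j, bU.coord i u * bV.coord j v * κ i j := by
    refine ⟨fun i j => φ (B (bU i) (bV j)), fun u v => ?_⟩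
    conv_lhs => rw [← bU.sum_repr u, ← bV.sum_repr v]
    simp only [map_sum, map_smul, LinearMap.sum_apply, LinearMap.smul_apply, smul_eq_mul,
      Module.Basis.coord_apply, Finset.mul_sum, mul_assoc]
    rw [Finset.sum_comm]
    refine Finset.sum_congr rfl fun i _ => Finset.sum_congr rfl fun j _ => by ring
  have := HasDerivAt.fun_sum (u := antidiagonal d) fun p _ =>
    HasDerivAt.fun_sum (u := Finset.univ) fun i _ =>
    HasDerivAt.fun_sum (u := Finset.univ) fun j _ =>
    (((h t p.1 (bU.coord i)).fun_mul (h' t p.2 (bV.coord j))).mul_const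
      (κ i j))
  simp only [DynR.cprod, map_sum, Pi.add_apply, map_add, key, ← Finset.sum_add_distrib]
  refine this.congr_deriv ?_
  simp only [add_mul]

/-- Functionals separate the points of a projective module, so the scalar mean value theorem
suffices. -/
theorem eq_of_deriv_zero [Module.Projective ℂ V] {F : ℂ → FormalFun n V} {d : Fin n →₀ ℕ}
    (h : HasCoeffDeriv F F') (h0 : ∀ t, F' t d = 0) (t : ℂ) : F t d = F 0 d := by
  rw [← sub_eq_zero, ← Module.forall_dual_apply_eq_zero_iff ℂ]
  intro φ
  rw [map_sub, sub_eq_zero]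
  refine is_const_of_deriv_eq_zero (f := fun s => φ (F s d))
    (fun s => (h s d φ).differentiableAt) (fun s => ?_) t 0
  rw [(h s d φ).deriv, h0, map_zero]

end HasCoeffDeriv

end Curves

/-! ### Exponential series as solutions of linear differential equations -/

section Exponential

variable {𝔤 : Type*} [LieRing 𝔤] [LieAlgebra ℂ 𝔤] {n : ℕ}
variable {V W : Type*} [AddCommGroup V] [Module ℂ V] [LieRingModule 𝔤 V] [LieModule ℂ 𝔤 V]

/-- The constant term of χ is zero, so a coefficient of χ·f sees only coefficients of f of strictly
smaller degree. -/
theorem act_apply_eq_zero {χ : FormalFun n 𝔤} (hχ : χ 0 = 0) {f : FormalFun n V}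
    {d : Fin n →₀ ℕ} (hf : ∀ e : Fin n →₀ ℕ, e.degree < d.degree → f e = 0) :
    act χ f d = 0 := by
  refine Finset.sum_eq_zero fun p hp => ?_
  have hp' : p.1 + p.2 = d := mem_antidiagonal.mp hp
  by_cases h : p.1 = 0
  · simp [h, hχ]
  · have h1 : p.1.degree ≠ 0 := by simpa [Finsupp.degree_eq_zero_iff] using h
    have h2 : p.1.degree + p.2.degree = d.degree := by rw [← hp', map_add]
    rw [hf p.2 (by omega), map_zero]

/-- Uniqueness for the linear differential equation `E' = χ · E`. -/
theorem HasCoeffDeriv.eq_zero [Module.Projective ℂ V] {χ : FormalFun n 𝔤} (hχ : χ 0 = 0)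
    {E : ℂ → FormalFun n V} (h : HasCoeffDeriv E fun t => act χ (E t)) (h0 : E 0 = 0) (t : ℂ) :
    E t = 0 := by
  suffices ∀ (k : ℕ) (d : Fin n →₀ ℕ), d.degree = k → ∀ t, E t d = 0 from
    funext fun d => this _ d rfl t
  intro k
  induction k using Nat.strong_induction_on with
  | _ k ih =>
    intro d hd t
    -- The derivative in degree k involves only lower degrees, which vanish for all t by induction;
    -- the coefficient is therefore constant in t.
    rw [h.eq_of_deriv_zero (fun s => act_apply_eq_zero hχ fun e he => ih _ (hd ▸ he) e rfl s), h0]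
    rfl

theorem act_eq_cprod (χ : FormalFun n 𝔤) (f : FormalFun n V) :
    act χ f = cprod (LieModule.toEnd ℂ 𝔤 V : 𝔤 →ₗ[ℂ] Module.End ℂ V) χ f := rfl

theorem act_add (χ : FormalFun n 𝔤) (f g : FormalFun n V) : act χ (f + g) = act χ f + act χ g :=
  cprod_add _ χ f g
theorem act_sub (χ : FormalFun n 𝔤) (f g : FormalFun n V) : act χ (f - g) = act χ f - act χ g :=
  cprod_sub _ χ f g
theorem act_sum {ι : Type*} (s : Finset ι) (χ : FormalFun n 𝔤) (f : ι → FormalFun n V) :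
    act χ (∑ i ∈ s, f i) = ∑ i ∈ s, act χ (f i) := cprod_sum _ s χ f
theorem act_smul (χ : FormalFun n 𝔤) (c : ℂ) (f : FormalFun n V) : act χ (c • f) = c • act χ f :=
  cprod_smul _ c χ f
theorem smul_act (c : ℂ) (χ : FormalFun n 𝔤) (f : FormalFun n V) : act (c • χ) f = c • act χ f :=
  cprod_smul_left _ c χ f

/-- The iterates of the action as linear maps. -/
def actIter (χ : FormalFun n 𝔤) (k : ℕ) : FormalFun n V →ₗ[ℂ] FormalFun n V :=
  (cprodHom (LieModule.toEnd ℂ 𝔤 V : 𝔤 →ₗ[ℂ] Module.End ℂ V) χ) ^ k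

theorem actIter_apply (χ : FormalFun n 𝔤) (k : ℕ) (f : FormalFun n V) :
    actIter χ k f = (act χ)^[k] f := by
  rw [actIter, Module.End.pow_apply]; rfl

theorem iterate_smul_act (c : ℂ) (χ : FormalFun n 𝔤) (k : ℕ) (f : FormalFun n V) :
    (act (c • χ))^[k] f = c ^ k • (act χ)^[k] f := by
  induction k with
  | zero => simp
  | succ k ih =>
    rw [Function.iterate_succ_apply', Function.iterate_succ_apply', ih, smul_act, act_smul,
      smul_smul, pow_succ']

theorem adSeries_smul_act (c : ℕ → ℂ) (s : ℂ) (χ : FormalFun n 𝔤) (f : FormalFun n V) :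
    adSeries c (s • χ) f = adSeries (fun k => c k * s ^ k) χ f := by
  ext d
  simp [adSeries, iterate_smul_act, smul_smul]

/-- `adSeries` as a linear map. -/
def adSeriesHom (c : ℕ → ℂ) (χ : FormalFun n 𝔤) : FormalFun n V →ₗ[ℂ] FormalFun n V where
  toFun := adSeries c χ
  map_add' f g := by
    ext d; simp [adSeries, ← actIter_apply, Finset.sum_add_distrib]
  map_smul' a f := by
    ext d; simp [adSeries, ← actIter_apply, Finset.smul_sum, smul_comm a]

theorem adSeries_zero (c : ℕ → ℂ) (χ : FormalFun n 𝔤) : adSeries c χ (0 : FormalFun n V) = 0 :=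
  map_zero (adSeriesHom c χ)
theorem adSeries_add (c : ℕ → ℂ) (χ : FormalFun n 𝔤) (f g : FormalFun n V) :
    adSeries c χ (f + g) = adSeries c χ f + adSeries c χ g := map_add (adSeriesHom c χ) f g
theorem adSeries_sub (c : ℕ → ℂ) (χ : FormalFun n 𝔤) (f g : FormalFun n V) :
    adSeries c χ (f - g) = adSeries c χ f - adSeries c χ g := map_sub (adSeriesHom c χ) f g
theorem adSeries_neg (c : ℕ → ℂ) (χ : FormalFun n 𝔤) (f : FormalFun n V) :
    adSeries c χ (-f) = -adSeries c χ f := map_neg (adSeriesHom c χ) f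
theorem adSeries_smul (c : ℕ → ℂ) (χ : FormalFun n 𝔤) (a : ℂ) (f : FormalFun n V) :
    adSeries c χ (a • f) = a • adSeries c χ f := map_smul (adSeriesHom c χ) a f
theorem adSeries_sum {ι : Type*} (s : Finset ι) (c : ℕ → ℂ) (χ : FormalFun n 𝔤)
    (f : ι → FormalFun n V) :
    adSeries c χ (∑ i ∈ s, f i) = ∑ i ∈ s, adSeries c χ (f i) := map_sum (adSeriesHom c χ) f s

/-- The coefficients of `z c(z)`. -/
def shiftCoeff (c : ℕ → ℂ) : ℕ → ℂ
  | 0 => 0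
  | k + 1 => c k

/-- The shift produces one term beyond the truncation, with |d| + 1 factors χ; it vanishes in degree
|d|. -/
theorem adSeries_act {χ : FormalFun n 𝔤} (hχ : χ 0 = 0) (c : ℕ → ℂ) (f : FormalFun n V) :
    adSeries c χ (act χ f) = adSeries (shiftCoeff c) χ f := by
  ext d
  rw [adSeries, adSeries, Finset.sum_range_succ, Finset.sum_range_succ' _ d.degree,
    ← Function.iterate_succ_apply,
    act_iterate_eq_zero χ hχ f (d.degree + 1) d (Nat.lt_succ_self _)]
  simp [shiftCoeff]

/-- The truncation of the series depends on the degree, so the action cannot be moved inside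
termwise. In degrees below |d| the series equals its truncation at |d|, and the coefficient at d
depends on those degrees only. -/
theorem act_adSeries {χ : FormalFun n 𝔤} (hχ : χ 0 = 0) (c : ℕ → ℂ) (f : FormalFun n V) :
    act χ (adSeries c χ f) = adSeries c χ (act χ f) := by
  ext d
  have : act χ (adSeries c χ f) d =
      act χ (∑ k ∈ Finset.range (d.degree + 1), c k • (act χ)^[k] f) d := by
    rw [← sub_eq_zero, ← Pi.sub_apply, ← act_sub]
    refine act_apply_eq_zero hχ fun e he => ?_
    rw [Pi.sub_apply, sub_eq_zero, Finset.sum_apply, adSeries]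
    refine Finset.sum_subset (Finset.range_mono (by omega)) fun k _ hk => ?_
    rw [act_iterate_eq_zero χ hχ f k e (by simpa using hk), smul_zero]
  rw [this, act_sum, Finset.sum_apply, adSeries]
  refine Finset.sum_congr rfl fun k _ => ?_
  rw [act_smul, ← Function.iterate_succ_apply' (act χ), Function.iterate_succ_apply]
  rfl

theorem adSeries_zero_left (c : ℕ → ℂ) (f : FormalFun n V) :
    adSeries c (0 : FormalFun n 𝔤) f = c 0 • f := by
  ext d
  rw [← zero_smul ℂ (0 : FormalFun n 𝔤), adSeries_smul_act, adSeries, Finset.sum_range_succ']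
  simp

theorem expAct_zero_left (f : FormalFun n V) : expAct (0 : FormalFun n 𝔤) f = f := by
  rw [expAct, adSeries_zero_left]; simp

theorem HasCoeffDeriv.act [FiniteDimensional ℂ 𝔤] [FiniteDimensional ℂ V] (χ : FormalFun n 𝔤)
    {F F' : ℂ → FormalFun n V} (h : HasCoeffDeriv F F') :
    HasCoeffDeriv (fun t => act χ (F t)) (fun t => DynR.act χ (F' t)) :=
  ((HasCoeffDeriv.const χ).cprod _ h).congr fun t => by
    rw [cprod_zero_left, zero_add, act_eq_cprod]

theorem HasCoeffDeriv.adSeries [FiniteDimensional ℂ 𝔤] [FiniteDimensional ℂ V]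
    (χ : FormalFun n 𝔤) {F F' : ℂ → FormalFun n V} (h : HasCoeffDeriv F F')
    {c c' : ℂ → ℕ → ℂ} (hc : ∀ t k, HasDerivAt (fun s => c s k) (c' t k) t) :
    HasCoeffDeriv (fun t => adSeries (c t) χ (F t))
      (fun t => DynR.adSeries (c' t) χ (F t) + DynR.adSeries (c t) χ (F' t)) := by
  have hk (k : ℕ) : HasCoeffDeriv (fun t => (DynR.act χ)^[k] (F t))
      (fun t => (DynR.act χ)^[k] (F' t)) := by
    induction k with
    | zero => exact h
    | succ k ih =>
      simp only [Function.iterate_succ_apply']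
      exact ih.act χ
  intro t d φ
  simp only [DynR.adSeries, Pi.add_apply, ← Finset.sum_add_distrib, map_sum, map_add, map_smul,
    smul_eq_mul]
  exact HasDerivAt.fun_sum fun k _ => (hc t k).fun_mul (hk k t d φ)

/-- Differentiating (at)^k / k! shifts the series by one place, which is one more factor aχ. The
scalar a makes e^{-tχ} available as well. -/
theorem HasCoeffDeriv.expAct [FiniteDimensional ℂ 𝔤] [FiniteDimensional ℂ V]
    {χ : FormalFun n 𝔤} (hχ : χ 0 = 0) (a : ℂ) {F F' : ℂ → FormalFun n V}
    (h : HasCoeffDeriv F F') :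
    HasCoeffDeriv (fun t => expAct ((a * t) • χ) (F t))
      (fun t => a • DynR.act χ (DynR.expAct ((a * t) • χ) (F t)) +
        DynR.expAct ((a * t) • χ) (F' t)) := by
  simp only [DynR.expAct, adSeries_smul_act]
  refine (h.adSeries χ (c' := fun t k =>
    a * shiftCoeff (fun k => (k.factorial : ℂ)⁻¹ * (a * t) ^ k) k) ?_).congr fun t => ?_
  · intro t k
    cases k with
    | zero => simpa [shiftCoeff] using hasDerivAt_const t (1 : ℂ)
    | succ k =>
      refine ((((hasDerivAt_id t).const_mul a).pow (k + 1)).const_mul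
        (((k + 1).factorial : ℂ)⁻¹)).congr_deriv ?_
      have : ((k + 1 : ℕ) : ℂ) ≠ 0 := Nat.cast_ne_zero.mpr (Nat.succ_ne_zero k)
      have : (k.factorial : ℂ) ≠ 0 := Nat.cast_ne_zero.mpr k.factorial_ne_zero
      simp only [shiftCoeff, Nat.factorial_succ, Nat.cast_mul, id, Nat.add_sub_cancel]
      field_simp
  · rw [act_adSeries hχ, adSeries_act hχ]
    congr 1
    ext d
    simp [DynR.adSeries, Finset.smul_sum, mul_smul]

theorem HasCoeffDeriv.expAct_smul [FiniteDimensional ℂ 𝔤] [FiniteDimensional ℂ V]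
    {χ : FormalFun n 𝔤} (hχ : χ 0 = 0) {F F' : ℂ → FormalFun n V} (h : HasCoeffDeriv F F') :
    HasCoeffDeriv (fun t => DynR.expAct (t • χ) (F t))
      (fun t => DynR.act χ (DynR.expAct (t • χ) (F t)) + DynR.expAct (t • χ) (F' t)) := by
  simpa using h.expAct hχ 1

/-- The curve in t on the left is constant: the contributions of χ and -χ to its derivative cancel,
since the action of χ commutes with its series. -/
theorem expAct_expAct_neg [FiniteDimensional ℂ 𝔤] [FiniteDimensional ℂ V] {χ : FormalFun n 𝔤}
    (hχ : χ 0 = 0) (f : FormalFun n V) (t : ℂ) :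
    expAct (t • χ) (expAct ((-t) • χ) f) = f := by
  have h := ((HasCoeffDeriv.const f).expAct hχ (-1)).expAct hχ 1
  have h' := h.congr (G' := fun t => 0) fun t => by
    simp only [one_mul, one_smul, neg_smul, neg_one_mul, expAct, adSeries_add, adSeries_neg]
    simp only [adSeries_smul_act, act_adSeries hχ, adSeries_zero, add_zero, add_neg_cancel]
  have := funext fun d => h'.eq_of_deriv_zero (d := d) (fun _ => rfl) t
  simpa [expAct_zero_left] using this

/-- The factor t in ∂ᵢ(tχ) turns the k-th coefficient into (-1)^k t^{k+1} / (k+1)!, whose derivative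
is the k-th coefficient of e^{-tχ}. This is what makes the gauge curve satisfy a simple equation. -/
theorem hasCoeffDeriv_etaComp [FiniteDimensional ℂ 𝔤] {χ : FormalFun n 𝔤} (i : Fin n) :
    HasCoeffDeriv (fun t => etaComp (t • χ) i) (fun t => expAct ((-t) • χ) (pderiv i χ)) := by
  have h := (HasCoeffDeriv.const (pderiv i χ)).adSeries χ
    (c := fun t k => (-1) ^ k * (((k + 1).factorial : ℂ))⁻¹ * t ^ (k + 1))
    (c' := fun t k => ((k.factorial : ℂ))⁻¹ * (-t) ^ k) fun t k => by
      refine ((hasDerivAt_pow (k + 1) t).const_mul _).congr_deriv ?_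
      have : ((k + 1 : ℕ) : ℂ) ≠ 0 := Nat.cast_ne_zero.mpr (Nat.succ_ne_zero k)
      have : (k.factorial : ℂ) ≠ 0 := Nat.cast_ne_zero.mpr k.factorial_ne_zero
      rw [neg_pow t]
      simp only [Nat.factorial_succ, Nat.cast_mul, Nat.add_sub_cancel]
      field_simp
  have h1 (t : ℂ) : adSeries (fun k => (-1) ^ k * (((k + 1).factorial : ℂ))⁻¹ * t ^ (k + 1)) χ
      (pderiv i χ) = etaComp (t • χ) i := by
    rw [etaComp, adSeries_smul_act, pderiv_smul, adSeries_smul]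
    ext d
    simp [adSeries, Finset.smul_sum, smul_smul, pow_succ, mul_comm, mul_assoc]
  simp only [h1] at h
  refine h.congr fun t => ?_
  rw [expAct, adSeries_smul_act]
  simp [adSeries_zero]

end Exponential

/-! ### Linear coefficients and the Lie derivative -/

section LieDerivative

variable {𝔤 : Type*} [LieRing 𝔤] [LieAlgebra ℂ 𝔤] {𝔩 : LieSubalgebra ℂ 𝔤} {n : ℕ}
variable (b : Module.Basis (Fin n) ℂ 𝔩)
variable {U V W : Type*}
variable [AddCommGroup U] [Module ℂ U] [AddCommGroup V] [Module ℂ V] [AddCommGroup W] [Module ℂ W]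

/-- `linFun` as a linear map. -/
def linFunHom : 𝔩 →ₗ[ℂ] FormalFun n ℂ where
  toFun := linFun b
  map_add' x y := by
    simp only [linFun, map_add, Finsupp.add_apply, Pi.single_add, Finset.sum_add_distrib]
  map_smul' c x := by
    simp only [linFun, map_smul, Finsupp.smul_apply, Pi.single_smul, Finset.smul_sum,
      RingHom.id_apply]

/-- `mulLin` as a bilinear map. -/
def mulLinHom : 𝔩 →ₗ[ℂ] FormalFun n V →ₗ[ℂ] FormalFun n V :=
  cprodHom (LinearMap.lsmul ℂ V) ∘ₗ linFunHom b

theorem mulLin_add (y : 𝔩) (f g : FormalFun n V) :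
    mulLin b y (f + g) = mulLin b y f + mulLin b y g := map_add (mulLinHom b y) f g
theorem mulLin_sub (y : 𝔩) (f g : FormalFun n V) :
    mulLin b y (f - g) = mulLin b y f - mulLin b y g := map_sub (mulLinHom b y) f g
theorem mulLin_zero (y : 𝔩) : mulLin b y (0 : FormalFun n V) = 0 := map_zero (mulLinHom b y)
theorem mulLin_smul (y : 𝔩) (c : ℂ) (f : FormalFun n V) :
    mulLin b y (c • f) = c • mulLin b y f := map_smul (mulLinHom b y) c f
theorem mulLin_sum {ι : Type*} (s : Finset ι) (y : 𝔩) (f : ι → FormalFun n V) :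
    mulLin b y (∑ i ∈ s, f i) = ∑ i ∈ s, mulLin b y (f i) := map_sum (mulLinHom b y) f s
theorem neg_mulLin (y : 𝔩) (f : FormalFun n V) : mulLin b (-y) f = -mulLin b y f :=
  (mulLinHom b).map_neg₂ y f
theorem smul_mulLin (c : ℂ) (y : 𝔩) (f : FormalFun n V) : mulLin b (c • y) f = c • mulLin b y f :=
  (mulLinHom b).map_smul₂ c y f
theorem sum_mulLin {ι : Type*} (s : Finset ι) (y : ι → 𝔩) (f : FormalFun n V) :
    mulLin b (∑ i ∈ s, y i) f = ∑ i ∈ s, mulLin b (y i) f := (mulLinHom b).map_sum₂ s y f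

theorem mapVal_mulLin (L : V →ₗ[ℂ] W) (y : 𝔩) (f : FormalFun n V) :
    mapVal L (mulLin b y f) = mulLin b y (mapVal L f) := by
  ext d; simp [mulLin, mapVal, cprod]

theorem cprod_mulLin (B : U →ₗ[ℂ] V →ₗ[ℂ] W) (y : 𝔩) (f : FormalFun n U) (g : FormalFun n V) :
    cprod B f (mulLin b y g) = mulLin b y (cprod B f g) :=
  cprod_left_comm (by simp) f (linFun b y) g

theorem cprod_mulLin_left (B : U →ₗ[ℂ] V →ₗ[ℂ] W) (y : 𝔩) (f : FormalFun n U)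
    (g : FormalFun n V) : cprod B (mulLin b y f) g = mulLin b y (cprod B f g) := by
  rw [cprod_flip, cprod_mulLin, ← cprod_flip]

theorem linFun_zero (y : 𝔩) : linFun b y 0 = 0 := by
  simp [linFun]

theorem mulLin_apply_zero (y : 𝔩) (f : FormalFun n V) : mulLin b y f 0 = 0 := by
  simp [mulLin, cprod_apply_zero, linFun_zero]

theorem pderiv_linFun (y : 𝔩) (i : Fin n) : pderiv i (linFun b y) = const n (b.repr y i) := by
  ext d
  rw [linFun, pderiv_sum, Finset.sum_apply, Finset.sum_eq_single i]
  · by_cases h : d = 0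
    · simp [pderiv, const, h]
    · simp [pderiv, const, h]
  · intro j _ hj
    have : d + Finsupp.single i 1 ≠ Finsupp.single j 1 := fun h => by
      simpa [Finsupp.single_apply, hj] using DFunLike.congr_fun h i
    simp [pderiv, this]
  · simp

theorem pderiv_mulLin (y : 𝔩) (i : Fin n) (f : FormalFun n V) :
    pderiv i (mulLin b y f) = b.repr y i • f + mulLin b y (pderiv i f) := by
  rw [mulLin, pderiv_cprod, pderiv_linFun, cprod_const_left]
  rfl

/-- The vector field on `D` by which `y ∈ 𝔩` acts. -/
def lieD (y : 𝔩) (f : FormalFun n V) : FormalFun n V := ∑ i, mulLin b ⁅b i, y⁆ (pderiv i f)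

theorem lieD_add (y : 𝔩) (f g : FormalFun n V) :
    lieD b y (f + g) = lieD b y f + lieD b y g := by
  simp [lieD, pderiv_add, mulLin_add, Finset.sum_add_distrib]
theorem lieD_sub (y : 𝔩) (f g : FormalFun n V) :
    lieD b y (f - g) = lieD b y f - lieD b y g := by
  simp [lieD, pderiv_sub, mulLin_sub, Finset.sum_sub_distrib]
theorem lieD_zero (y : 𝔩) : lieD b y (0 : FormalFun n V) = 0 := by
  simp [lieD, pderiv_zero, mulLin_zero]
theorem lieD_sum {ι : Type*} (s : Finset ι) (y : 𝔩) (f : ι → FormalFun n V) :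
    lieD b y (∑ i ∈ s, f i) = ∑ i ∈ s, lieD b y (f i) := by
  simp only [lieD, pderiv_sum, mulLin_sum]
  exact Finset.sum_comm
theorem lieD_const (y : 𝔩) (v : V) : lieD b y (const n v) = 0 := by
  simp [lieD, pderiv_const, mulLin_zero]
theorem mapVal_lieD (L : V →ₗ[ℂ] W) (y : 𝔩) (f : FormalFun n V) :
    mapVal L (lieD b y f) = lieD b y (mapVal L f) := by
  simp [lieD, mapVal_sum, mapVal_mulLin, pderiv_mapVal]
theorem lieD_apply_zero (y : 𝔩) (f : FormalFun n V) : lieD b y f 0 = 0 := by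
  simp [lieD, mulLin_apply_zero]
theorem lieD_cprod (B : U →ₗ[ℂ] V →ₗ[ℂ] W) (y : 𝔩) (f : FormalFun n U) (g : FormalFun n V) :
    lieD b y (cprod B f g) = cprod B (lieD b y f) g + cprod B f (lieD b y g) := by
  simp [lieD, pderiv_cprod, mulLin_add, cprod_sum, cprod_sum_left, cprod_mulLin,
    cprod_mulLin_left, Finset.sum_add_distrib]
-- The correction comes from differentiating the linear coefficients of the vector field.
theorem pderiv_lieD (y : 𝔩) (i : Fin n) (f : FormalFun n V) :
    pderiv i (lieD b y f) = lieD b y (pderiv i f) + ∑ j, b.repr ⁅b j, y⁆ i • pderiv j f := by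
  simp [lieD, pderiv_sum, pderiv_mulLin, Finset.sum_add_distrib, pderiv_comm i, add_comm]
theorem lieD_mulLin (x y : 𝔩) (f : FormalFun n V) :
    lieD b y (mulLin b x f) = mulLin b ⁅x, y⁆ f + mulLin b x (lieD b y f) := by
  have h : ⁅x, y⁆ = ∑ i, b.repr x i • ⁅b i, y⁆ := by
    conv_lhs => rw [← b.sum_repr x, sum_lie]
    simp
  rw [h, sum_mulLin]
  simp only [lieD, pderiv_mulLin, mulLin_add, mulLin_sum, Finset.sum_add_distrib, smul_mulLin,
    mulLin_smul, add_right_inj]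
  exact Finset.sum_congr rfl fun i _ => cprod_mulLin b _ _ _ _

/-- The formal differential `∑ i, xᵢ ⊗ ∂ᵢ f`. -/
def dBar (f : FormalFun n V) : FormalFun n (𝔤 ⊗[ℂ] V) :=
  ∑ i, mapVal (TensorProduct.mk ℂ 𝔤 V (b i : 𝔤)) (pderiv i f)

theorem dBar_add (f g : FormalFun n V) : dBar b (f + g) = dBar b f + dBar b g := by
  simp [dBar, pderiv_add, mapVal_add, Finset.sum_add_distrib]
theorem dBar_sub (f g : FormalFun n V) : dBar b (f - g) = dBar b f - dBar b g := by
  simp [dBar, pderiv_sub, mapVal_sub]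

theorem altD_eq (r : FormalFun n (𝔤 ⊗[ℂ] 𝔤)) : altD b r = mapVal (Alt 𝔤) (dBar b r) := rfl

theorem altD_sub (r s : FormalFun n (𝔤 ⊗[ℂ] 𝔤)) : altD b (r - s) = altD b r - altD b s := by
  rw [altD_eq, dBar_sub, mapVal_sub]; rfl

theorem HasCoeffDeriv.mulLin [FiniteDimensional ℂ V] (y : 𝔩)
    {F F' : ℂ → FormalFun n V} (h : HasCoeffDeriv F F') :
    HasCoeffDeriv (fun t => mulLin b y (F t)) (fun t => DynR.mulLin b y (F' t)) :=
  ((HasCoeffDeriv.const (linFun b y)).cprod _ h).congr fun t => by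
    rw [cprod_zero_left, zero_add, DynR.mulLin]

theorem HasCoeffDeriv.lieD [FiniteDimensional ℂ V] (y : 𝔩)
    {F F' : ℂ → FormalFun n V} (h : HasCoeffDeriv F F') :
    HasCoeffDeriv (fun t => lieD b y (F t)) (fun t => DynR.lieD b y (F' t)) :=
  HasCoeffDeriv.sum fun i _ => (h.pderiv i).mulLin b _

theorem HasCoeffDeriv.dBar {F F' : ℂ → FormalFun n V} (h : HasCoeffDeriv F F') :
    HasCoeffDeriv (fun t => dBar b (F t)) (fun t => DynR.dBar b (F' t)) :=
  HasCoeffDeriv.sum fun i _ => (h.pderiv i).mapVal _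

end LieDerivative

/-! ### The gauge transforms by `e^{tχ}` -/

section Action

variable {𝔤 : Type*} [LieRing 𝔤] [LieAlgebra ℂ 𝔤] {n : ℕ}
variable {U V W : Type*} [AddCommGroup U] [Module ℂ U] [LieRingModule 𝔤 U] [LieModule ℂ 𝔤 U]
  [AddCommGroup V] [Module ℂ V] [LieRingModule 𝔤 V] [LieModule ℂ 𝔤 V]
  [AddCommGroup W] [Module ℂ W] [LieRingModule 𝔤 W] [LieModule ℂ 𝔤 W]

theorem act_cprod {B : U →ₗ[ℂ] V →ₗ[ℂ] W}
    (hB : ∀ (x : 𝔤) u v, ⁅x, B u v⁆ = B ⁅x, u⁆ v + B u ⁅x, v⁆)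
    (χ : FormalFun n 𝔤) (f : FormalFun n U) (g : FormalFun n V) :
    act χ (cprod B f g) = cprod B (act χ f) g + cprod B f (act χ g) :=
  cprod_derivation (fun x u v => by simpa using hB x u v) χ f g

theorem mapVal_act {L : V →ₗ[ℂ] W} (hL : ∀ (x : 𝔤) v, L ⁅x, v⁆ = ⁅x, L v⁆)
    (χ : FormalFun n 𝔤) (f : FormalFun n V) : mapVal L (act χ f) = act χ (mapVal L f) := by
  ext d; simp [mapVal, act, cprod, hL]

theorem act_mulLin {𝔩 : LieSubalgebra ℂ 𝔤} (b : Module.Basis (Fin n) ℂ 𝔩) (y : 𝔩)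
    (χ : FormalFun n 𝔤) (f : FormalFun n V) : act χ (mulLin b y f) = mulLin b y (act χ f) :=
  cprod_mulLin b _ y χ f

variable [FiniteDimensional ℂ 𝔤] {χ : FormalFun n 𝔤}

/-- Both sides solve E' = χ·E with the same initial value, by the derivation property of the action.
The next two lemmas hold for the same reason. -/
theorem expAct_cprod
    [FiniteDimensional ℂ U] [FiniteDimensional ℂ V] [FiniteDimensional ℂ W]
    (hχ : χ 0 = 0) {B : U →ₗ[ℂ] V →ₗ[ℂ] W} (hB : ∀ (x : 𝔤) u v, ⁅x, B u v⁆ = B ⁅x, u⁆ v + B u ⁅x, v⁆)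
    (t : ℂ) (f : FormalFun n U) (g : FormalFun n V) :
    expAct (t • χ) (cprod B f g) = cprod B (expAct (t • χ) f) (expAct (t • χ) g) := by
  rw [← sub_eq_zero]
  refine HasCoeffDeriv.eq_zero hχ (E := fun t => expAct (t • χ) (cprod B f g) -
    cprod B (expAct (t • χ) f) (expAct (t • χ) g)) ?_ (by simp [expAct_zero_left]) t
  refine (((HasCoeffDeriv.const (cprod B f g)).expAct_smul hχ).sub
    (((HasCoeffDeriv.const f).expAct_smul hχ).cprod B
      ((HasCoeffDeriv.const g).expAct_smul hχ))).congr fun t => ?_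
  simp only [act_sub, act_cprod hB, expAct, adSeries_zero, add_zero]

theorem expAct_mapVal (hχ : χ 0 = 0) [FiniteDimensional ℂ V] [FiniteDimensional ℂ W]
    {L : V →ₗ[ℂ] W} (hL : ∀ (x : 𝔤) v, L ⁅x, v⁆ = ⁅x, L v⁆) (t : ℂ) (f : FormalFun n V) :
    expAct (t • χ) (mapVal L f) = mapVal L (expAct (t • χ) f) := by
  rw [← sub_eq_zero]
  refine HasCoeffDeriv.eq_zero hχ (E := fun t => expAct (t • χ) (mapVal L f) -
    mapVal L (expAct (t • χ) f)) ?_ (by simp [expAct_zero_left]) t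
  refine (((HasCoeffDeriv.const (mapVal L f)).expAct_smul hχ).sub
    (((HasCoeffDeriv.const f).expAct_smul hχ).mapVal L)).congr fun t => ?_
  simp only [act_sub, mapVal_act hL, expAct, adSeries_zero, add_zero]

theorem expAct_mulLin (hχ : χ 0 = 0) [FiniteDimensional ℂ V] {𝔩 : LieSubalgebra ℂ 𝔤}
    (b : Module.Basis (Fin n) ℂ 𝔩) (y : 𝔩) (t : ℂ) (f : FormalFun n V) :
    expAct (t • χ) (mulLin b y f) = mulLin b y (expAct (t • χ) f) := by
  rw [← sub_eq_zero]
  refine HasCoeffDeriv.eq_zero hχ (E := fun t => expAct (t • χ) (mulLin b y f) -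
    mulLin b y (expAct (t • χ) f)) ?_ (by simp [expAct_zero_left]) t
  refine (((HasCoeffDeriv.const (mulLin b y f)).expAct_smul hχ).sub
    (((HasCoeffDeriv.const f).expAct_smul hχ).mulLin b y)).congr fun t => ?_
  simp only [act_sub, act_mulLin, expAct, adSeries_zero, add_zero]

end Action

section GaugeCurve

variable {𝔤 : Type*} [LieRing 𝔤] [LieAlgebra ℂ 𝔤]
  {𝔩 : LieSubalgebra ℂ 𝔤} {n : ℕ} (b : Module.Basis (Fin n) ℂ 𝔩)
  {χ : FormalFun n 𝔤}

theorem act_const_of_equivariant (he : IsEquivariant b χ) (y : 𝔩) :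
    act χ (const n (y : 𝔤)) = -lieD b y χ := by
  rw [lieD, ← he y, act_eq_cprod, cprod_const]
  ext d
  simp [mapVal]

/-- `Ad(g⁻¹) y = y + ∑ j, [xⱼ, y] g⁻¹ ∂ⱼ g`, as a consequence of the equivariance of `g`. -/
theorem expAct_const_add_etaComp [FiniteDimensional ℂ 𝔤] (hχ : χ 0 = 0)
    (he : IsEquivariant b χ) (y : 𝔩) (t : ℂ) :
    expAct (t • χ) (const n (y : 𝔤) + ∑ j, mulLin b ⁅b j, y⁆ (etaComp (t • χ) j)) =
      const n (y : 𝔤) := by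
  rw [← sub_eq_zero]
  refine HasCoeffDeriv.eq_zero hχ (E := fun t => expAct (t • χ) (const n (y : 𝔤) +
    ∑ j, mulLin b ⁅b j, y⁆ (etaComp (t • χ) j)) - const n (y : 𝔤)) ?_ ?_ t
  · refine ((((HasCoeffDeriv.const (const n (y : 𝔤))).add (HasCoeffDeriv.sum fun j _ =>
      (hasCoeffDeriv_etaComp j).mulLin b ⁅b j, y⁆)).expAct_smul hχ).sub
      (HasCoeffDeriv.const (const n (y : 𝔤)))).congr fun t => ?_
    have : expAct (t • χ) (∑ j, mulLin b ⁅b j, y⁆ (expAct ((-t) • χ) (pderiv j χ))) =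
        lieD b y χ := by
      rw [expAct, adSeries_sum]
      refine Finset.sum_congr rfl fun j _ => ?_
      rw [← expAct, expAct_mulLin hχ, expAct_expAct_neg hχ]
    rw [zero_add, this, act_sub, act_const_of_equivariant b he]
    abel
  · simp [expAct_zero_left, etaComp, pderiv_zero, adSeries_zero, mulLin_zero]

/-- The infinitesimal gauge transformation of the constant function `0`, up to sign. -/
def gaugeShift (χ : FormalFun n 𝔤) : FormalFun n (𝔤 ⊗[ℂ] 𝔤) :=
  dBar b χ - mapVal (flip21 𝔤) (dBar b χ)

theorem flip21_lie (x : 𝔤) (v : 𝔤 ⊗[ℂ] 𝔤) : flip21 𝔤 ⁅x, v⁆ = ⁅x, flip21 𝔤 v⁆ := by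
  induction v with
  | zero => simp
  | add v w hv hw => simp [hv, hw]
  | tmul v w => simp [flip21, add_comm]

theorem flip21_flip21 (v : 𝔤 ⊗[ℂ] 𝔤) : flip21 𝔤 (flip21 𝔤 v) = v :=
  (TensorProduct.comm ℂ 𝔤 𝔤).symm_apply_apply v

theorem mapVal_flip21_cprod_mk (f g : FormalFun n 𝔤) :
    mapVal (flip21 𝔤) (cprod (TensorProduct.mk ℂ 𝔤 𝔤) f g) =
      cprod (TensorProduct.mk ℂ 𝔤 𝔤) g f := by
  rw [mapVal_cprod, cprod_flip]
  rfl

theorem mk_lie (x u v : 𝔤) : ⁅x, TensorProduct.mk ℂ 𝔤 𝔤 u v⁆ =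
    TensorProduct.mk ℂ 𝔤 𝔤 ⁅x, u⁆ v + TensorProduct.mk ℂ 𝔤 𝔤 u ⁅x, v⁆ := by simp

/-- The curve of gauge transforms by `e^{tχ}` solves an affine differential equation. -/
theorem hasCoeffDeriv_gaugeTransform [FiniteDimensional ℂ 𝔤] (hχ : χ 0 = 0)
    (he : IsEquivariant b χ) (r : FormalFun n (𝔤 ⊗[ℂ] 𝔤)) :
    HasCoeffDeriv (fun t => gaugeTransform b (t • χ) r)
      (fun t => act χ (gaugeTransform b (t • χ) r) - gaugeShift b χ) := by
  have hη := fun i => hasCoeffDeriv_etaComp (χ := χ) i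
  have hb : HasCoeffDeriv (fun t => etaBar b (t • χ)) _ :=
    HasCoeffDeriv.sum fun i _ => (hη i).mapVal (TensorProduct.mk ℂ 𝔤 𝔤 (b i : 𝔤))
  have hz : HasCoeffDeriv (fun t => zetaContr b (t • χ)) _ :=
    HasCoeffDeriv.sum fun i _ => HasCoeffDeriv.sum fun j _ =>
      ((hη i).cprod (TensorProduct.mk ℂ 𝔤 𝔤) (hη j)).mulLin b ⁅b i, b j⁆
  refine ((((HasCoeffDeriv.const r).sub hb).add (hb.mapVal (flip21 𝔤))).sub hz).expAct_smul hχ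
    |>.congr fun t => ?_
  rw [sub_eq_add_neg (act χ _)]
  refine congrArg₂ _ rfl ?_
  set η' : Fin n → FormalFun n 𝔤 := fun i => expAct ((-t) • χ) (pderiv i χ) with hη'
  -- By `expAct_const_add_etaComp`, `Y i` is Ad(g⁻¹) xᵢ for g = e^{tχ}.
  set Y : Fin n → FormalFun n 𝔤 := fun i =>
    const n (b i : 𝔤) + ∑ j, mulLin b ⁅b j, b i⁆ (etaComp (t • χ) j) with hY
  -- By skew-symmetry of [xᵢ, xⱼ], the two halves of the derivative of `zetaContr` supply exactly
  -- the corrections that turn xᵢ into Ad(g⁻¹) xᵢ in the term and in its flip.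
  have key : (0 : FormalFun n (𝔤 ⊗[ℂ] 𝔤))
      - ∑ i, mapVal (TensorProduct.mk ℂ 𝔤 𝔤 (b i : 𝔤)) (η' i)
      + mapVal (flip21 𝔤) (∑ i, mapVal (TensorProduct.mk ℂ 𝔤 𝔤 (b i : 𝔤)) (η' i))
      - ∑ i, ∑ j, mulLin b ⁅b i, b j⁆
        (cprod (TensorProduct.mk ℂ 𝔤 𝔤) (η' i) (etaComp (t • χ) j) +
          cprod (TensorProduct.mk ℂ 𝔤 𝔤) (etaComp (t • χ) i) (η' j)) =
      -(∑ i, cprod (TensorProduct.mk ℂ 𝔤 𝔤) (Y i) (η' i) -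
        mapVal (flip21 𝔤) (∑ i, cprod (TensorProduct.mk ℂ 𝔤 𝔤) (Y i) (η' i))) := by
    have h1 : ∑ i, ∑ j, mulLin b ⁅b i, b j⁆
        (cprod (TensorProduct.mk ℂ 𝔤 𝔤) (η' i) (etaComp (t • χ) j)) =
        -∑ i, ∑ j, mulLin b ⁅b j, b i⁆
          (cprod (TensorProduct.mk ℂ 𝔤 𝔤) (η' i) (etaComp (t • χ) j)) := by
      simp only [← Finset.sum_neg_distrib, ← neg_mulLin, lie_skew]
    have h2 : ∑ i, ∑ j, mulLin b ⁅b i, b j⁆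
        (cprod (TensorProduct.mk ℂ 𝔤 𝔤) (etaComp (t • χ) i) (η' j)) =
        ∑ i, ∑ j, mulLin b ⁅b j, b i⁆
          (cprod (TensorProduct.mk ℂ 𝔤 𝔤) (etaComp (t • χ) j) (η' i)) := Finset.sum_comm
    simp only [mulLin_add, Finset.sum_add_distrib, h1, h2, hY, cprod_add_left, cprod_const_left,
      cprod_sum_left, cprod_mulLin_left, mapVal_add, mapVal_sum, mapVal_mulLin,
      mapVal_flip21_cprod_mk]
    abel
  -- Conjugation by g restores xᵢ in the first factor and ∂ᵢχ in the second.
  have h3 : expAct (t • χ) (∑ i, cprod (TensorProduct.mk ℂ 𝔤 𝔤) (Y i) (η' i)) = dBar b χ := by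
    rw [expAct, adSeries_sum]
    refine Finset.sum_congr rfl fun i _ => ?_
    rw [← expAct, expAct_cprod hχ mk_lie, hY, expAct_const_add_etaComp b hχ he,
      expAct_expAct_neg hχ, cprod_const_left]
  refine (congrArg (expAct (t • χ)) key).trans ?_
  rw [expAct, adSeries_neg, adSeries_sub, ← expAct, ← expAct, expAct_mapVal hχ flip21_lie, h3,
    gaugeShift]

theorem gaugeTransform_zero (r : FormalFun n (𝔤 ⊗[ℂ] 𝔤)) :
    gaugeTransform b 0 r = r := by
  have h (i : Fin n) : etaComp (0 : FormalFun n 𝔤) i = 0 := by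
    rw [etaComp, pderiv_zero, adSeries_zero]
  simp [gaugeTransform, expAct_zero_left, etaBar, zetaContr, h, mapVal_zero, cprod_zero,
    mulLin_zero]

end GaugeCurve

/-! ### Gauge transforms of dynamical r-matrices -/

section YangBaxter

variable {𝔤 : Type*} [LieRing 𝔤] [LieAlgebra ℂ 𝔤]

variable (𝔤) in
/-- The bilinear map whose quadratic form is the Yang–Baxter operator. -/
def cybBil : (𝔤 ⊗[ℂ] 𝔤) →ₗ[ℂ] (𝔤 ⊗[ℂ] 𝔤) →ₗ[ℂ] (𝔤 ⊗[ℂ] (𝔤 ⊗[ℂ] 𝔤)) :=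
  br1213 𝔤 + br1223 𝔤 + br1323 𝔤

theorem cybBil_tmul (a₁ a₂ b₁ b₂ : 𝔤) :
    cybBil 𝔤 (a₁ ⊗ₜ a₂) (b₁ ⊗ₜ b₂) = ⁅a₁, b₁⁆ ⊗ₜ (a₂ ⊗ₜ b₂) + a₁ ⊗ₜ (⁅a₂, b₁⁆ ⊗ₜ b₂) +
      a₁ ⊗ₜ (b₁ ⊗ₜ ⁅a₂, b₂⁆) := rfl

theorem CYBFun_eq {n : ℕ} (r : FormalFun n (𝔤 ⊗[ℂ] 𝔤)) : CYBFun r = cprod (cybBil 𝔤) r r := by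
  ext d
  simp [CYBFun, cprod, cybBil, Finset.sum_add_distrib]

theorem lie_cybBil (x : 𝔤) (r s : 𝔤 ⊗[ℂ] 𝔤) :
    ⁅x, cybBil 𝔤 r s⁆ = cybBil 𝔤 ⁅x, r⁆ s + cybBil 𝔤 r ⁅x, s⁆ := by
  induction r with
  | zero => simp
  | add r r' hr hr' => simp only [map_add, LinearMap.add_apply, lie_add, hr, hr']; abel
  | tmul a a' =>
    induction s with
    | zero => simp
    | add s s' hs hs' => simp only [map_add, lie_add, hs, hs']; abel
    | tmul c c' =>
      simp only [cybBil_tmul, TensorProduct.LieModule.lie_tmul_right, lie_add, map_add,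
        LinearMap.add_apply, TensorProduct.tmul_add, TensorProduct.add_tmul, leibniz_lie x]
      abel

theorem Alt_lie (x : 𝔤) (v : 𝔤 ⊗[ℂ] (𝔤 ⊗[ℂ] 𝔤)) : Alt 𝔤 ⁅x, v⁆ = ⁅x, Alt 𝔤 v⁆ := by
  induction v with
  | zero => simp
  | add v w hv hw => simp [hv, hw]
  | tmul a w =>
    induction w with
    | zero => simp
    | add v w hv hw => simp only [TensorProduct.tmul_add, lie_add, map_add, hv, hw]
    | tmul b c =>
      simp only [TensorProduct.LieModule.lie_tmul_right, TensorProduct.tmul_add, map_add, lie_add,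
        lie_sub, Alt_tmul]
      abel

/-- The polarized Yang–Baxter operator at `a ∧ c`. -/
theorem cybBil_polarized (a c : 𝔤) (r : 𝔤 ⊗[ℂ] 𝔤) :
    cybBil 𝔤 (a ⊗ₜ c - c ⊗ₜ a) r + cybBil 𝔤 r (a ⊗ₜ c - c ⊗ₜ a) =
      Alt 𝔤 (a ⊗ₜ ⁅c, r⁆) - Alt 𝔤 (c ⊗ₜ ⁅a, r⁆) := by
  induction r with
  | zero => simp
  | add r s hr hs =>
    simp only [map_add, LinearMap.add_apply, lie_add, TensorProduct.tmul_add]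
    rw [add_add_add_comm, hr, hs]
    abel
  | tmul p q =>
    simp only [map_sub, LinearMap.sub_apply, cybBil_tmul, TensorProduct.LieModule.lie_tmul_right,
      TensorProduct.tmul_add, map_add, Alt_tmul]
    rw [← lie_skew p a, ← lie_skew p c, ← lie_skew q a, ← lie_skew q c]
    simp only [TensorProduct.tmul_neg, TensorProduct.neg_tmul]
    abel

end YangBaxter

/-! ### Infinitesimal covariance and invariance of the defining conditions -/

section Preservation

variable {𝔤 : Type*} [LieRing 𝔤] [LieAlgebra ℂ 𝔤] {𝔩 : LieSubalgebra ℂ 𝔤} {n : ℕ}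
  (b : Module.Basis (Fin n) ℂ 𝔩) {χ : FormalFun n 𝔤}

theorem isEquivariant_iff {V : Type*} [AddCommGroup V] [Module ℂ V] [LieRingModule 𝔤 V]
    [LieModule ℂ 𝔤 V] {f : FormalFun n V} : IsEquivariant b f ↔
      ∀ y : 𝔩, mapVal (LieModule.toEnd ℂ 𝔤 V (y : 𝔤)) f = lieD b y f := Iff.rfl

theorem IsEquivariant.sub {V : Type*} [AddCommGroup V] [Module ℂ V] [LieRingModule 𝔤 V]
    [LieModule ℂ 𝔤 V] {f g : FormalFun n V} (hf : IsEquivariant b f) (hg : IsEquivariant b g) :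
    IsEquivariant b (f - g) := by
  rw [isEquivariant_iff] at *
  intro y
  rw [mapVal_sub, lieD_sub, hf, hg]

theorem IsEquivariant.mapVal {V W : Type*} [AddCommGroup V] [Module ℂ V] [LieRingModule 𝔤 V]
    [LieModule ℂ 𝔤 V] [AddCommGroup W] [Module ℂ W] [LieRingModule 𝔤 W] [LieModule ℂ 𝔤 W]
    {f : FormalFun n V} (hf : IsEquivariant b f) {L : V →ₗ[ℂ] W}
    (hL : ∀ y : 𝔩, ∀ v, L ⁅(y : 𝔤), v⁆ = ⁅(y : 𝔤), L v⁆) : IsEquivariant b (mapVal L f) := by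
  rw [isEquivariant_iff] at *
  intro y
  rw [← mapVal_lieD, ← hf]
  ext d
  simp [DynR.mapVal, hL]

/-- The action of y on the factor xᵢ cancels against the commutator of ∂ᵢ with the vector field of
y. -/
theorem IsEquivariant.dBar {V : Type*} [AddCommGroup V] [Module ℂ V] [LieRingModule 𝔤 V]
    [LieModule ℂ 𝔤 V] {f : FormalFun n V} (hf : IsEquivariant b f) :
    IsEquivariant b (dBar b f) := by
  rw [isEquivariant_iff] at *
  intro y
  have h1 (i : Fin n) : DynR.mapVal (LieModule.toEnd ℂ 𝔤 (𝔤 ⊗[ℂ] V) (y : 𝔤))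
      (DynR.mapVal (TensorProduct.mk ℂ 𝔤 V (b i : 𝔤)) (pderiv i f)) =
      DynR.mapVal (TensorProduct.mk ℂ 𝔤 V ⁅(y : 𝔤), (b i : 𝔤)⁆) (pderiv i f) +
      DynR.mapVal (TensorProduct.mk ℂ 𝔤 V (b i : 𝔤))
        (lieD b y (pderiv i f) + ∑ j, b.repr ⁅b j, y⁆ i • pderiv j f) := by
    rw [← pderiv_lieD, ← hf, pderiv_mapVal]
    ext d
    simp [DynR.mapVal]
  have h2 (j : Fin n) (d : Fin n →₀ ℕ) : ∑ i, (b i : 𝔤) ⊗ₜ[ℂ] (b.repr ⁅b j, y⁆ i • pderiv j f d) =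
      ⁅(b j : 𝔤), (y : 𝔤)⁆ ⊗ₜ pderiv j f d := by
    have := congrArg (fun z : 𝔩 => (z : 𝔤)) (b.sum_repr ⁅b j, y⁆)
    simp only [LieSubalgebra.coe_bracket, AddSubmonoidClass.coe_finsetSum, SetLike.val_smul]
      at this
    simp only [← this, TensorProduct.sum_tmul, TensorProduct.smul_tmul]
  rw [DynR.dBar, mapVal_sum, lieD_sum]
  simp only [h1, mapVal_add, mapVal_lieD, mapVal_sum, mapVal_smul, Finset.sum_add_distrib]
  ext d
  simp only [Pi.add_apply, Finset.sum_apply, Pi.smul_apply, mapVal_apply, TensorProduct.mk_apply,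
    ← TensorProduct.tmul_smul]
  rw [Finset.sum_comm (f := fun i j => (b i : 𝔤) ⊗ₜ[ℂ] (b.repr ⁅b j, y⁆ i • pderiv j f d))]
  simp only [h2]
  have h3 (i : Fin n) : ⁅(y : 𝔤), (b i : 𝔤)⁆ ⊗ₜ[ℂ] pderiv i f d +
      ⁅(b i : 𝔤), (y : 𝔤)⁆ ⊗ₜ[ℂ] pderiv i f d = 0 := by
    rw [← TensorProduct.add_tmul, ← lie_skew, neg_add_cancel, TensorProduct.zero_tmul]
  rw [add_left_comm, ← Finset.sum_add_distrib]
  simp only [h3, Finset.sum_const_zero, add_zero]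

theorem IsEquivariant.gaugeShift (he : IsEquivariant b χ) : IsEquivariant b (gaugeShift b χ) :=
  (he.dBar b).sub b ((he.dBar b).mapVal b fun y => flip21_lie (y : 𝔤))

theorem mapVal_flip21_gaugeShift : mapVal (flip21 𝔤) (gaugeShift b χ) = -gaugeShift b χ := by
  ext d
  simp [gaugeShift, mapVal, flip21_flip21]

/-- An instance of d² = 0: second derivatives are symmetric, and the six tensors cancel in pairs
after exchanging i and j. -/
theorem altD_gaugeShift : altD b (gaugeShift b χ) = 0 := by
  ext d
  let c : Fin n → Fin n → 𝔤 := fun i j => pderiv i (pderiv j χ) d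
  have hc (i j) : c i j = c j i := by simp only [c]; rw [pderiv_comm]
  have h : altD b (gaugeShift b χ) d = ∑ i, ∑ j, Alt 𝔤 ((b i : 𝔤) ⊗ₜ
      ((b j : 𝔤) ⊗ₜ c i j - c i j ⊗ₜ (b j : 𝔤))) := by
    simp [altD, gaugeShift, dBar, pderiv_sub, pderiv_sum, pderiv_mapVal, mapVal_sum, mapVal_sub,
      mapVal_apply, TensorProduct.tmul_sub, flip21, c]
  rw [h]
  simp only [TensorProduct.tmul_sub, map_sub, Alt_tmul]
  have h1 : ∑ i, ∑ j, (b j : 𝔤) ⊗ₜ[ℂ] ((b i : 𝔤) ⊗ₜ[ℂ] c i j) =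
      ∑ i, ∑ j, (b i : 𝔤) ⊗ₜ[ℂ] ((b j : 𝔤) ⊗ₜ[ℂ] c i j) := by
    rw [Finset.sum_comm]; simp only [hc]
  have h2 : ∑ i, ∑ j, (b j : 𝔤) ⊗ₜ[ℂ] (c i j ⊗ₜ[ℂ] (b i : 𝔤)) =
      ∑ i, ∑ j, (b i : 𝔤) ⊗ₜ[ℂ] (c i j ⊗ₜ[ℂ] (b j : 𝔤)) := by
    rw [Finset.sum_comm]; simp only [hc]
  have h3 : ∑ i, ∑ j, c i j ⊗ₜ[ℂ] ((b j : 𝔤) ⊗ₜ[ℂ] (b i : 𝔤)) =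
      ∑ i, ∑ j, c i j ⊗ₜ[ℂ] ((b i : 𝔤) ⊗ₜ[ℂ] (b j : 𝔤)) := by
    rw [Finset.sum_comm]; simp only [hc]
  simp only [Finset.sum_sub_distrib, Finset.sum_add_distrib, h1, h2, h3]
  simp

theorem act_const_eq_zero {V : Type*} [AddCommGroup V] [Module ℂ V] [LieRingModule 𝔤 V]
    [LieModule ℂ 𝔤 V] {v : V} (hv : ∀ x : 𝔤, ⁅x, v⁆ = 0) : act χ (const n v) = 0 := by
  rw [act_eq_cprod, cprod_const]
  ext d
  simp [mapVal, hv]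

/-- Besides the Leibniz term with ∂ᵢχ, a defect arises because χ also acts on the factor xᵢ.
Equivariance of χ writes it through [xⱼ, xᵢ] ∂ⱼχ ⊗ ∂ᵢr, and equivariance of r resums this to ∂ⱼχ ⊗
xⱼ·r. -/
theorem dBar_act (he : IsEquivariant b χ) {r : FormalFun n (𝔤 ⊗[ℂ] 𝔤)} (hr : IsEquivariant b r) :
    dBar b (act χ r) = act χ (dBar b r) +
      ∑ i, (mapVal (TensorProduct.mk ℂ 𝔤 (𝔤 ⊗[ℂ] 𝔤) (b i : 𝔤)) (act (pderiv i χ) r) -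
        cprod (TensorProduct.mk ℂ 𝔤 (𝔤 ⊗[ℂ] 𝔤)) (pderiv i χ)
          (mapVal (LieModule.toEnd ℂ 𝔤 (𝔤 ⊗[ℂ] 𝔤) (b i : 𝔤)) r)) := by
  have h1 (i : Fin n) : act χ (mapVal (TensorProduct.mk ℂ 𝔤 (𝔤 ⊗[ℂ] 𝔤) (b i : 𝔤)) (pderiv i r)) =
      mapVal (TensorProduct.mk ℂ 𝔤 (𝔤 ⊗[ℂ] 𝔤) (b i : 𝔤)) (act χ (pderiv i r)) -
      ∑ j, mulLin b ⁅b j, b i⁆ (cprod (TensorProduct.mk ℂ 𝔤 (𝔤 ⊗[ℂ] 𝔤)) (pderiv j χ)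
        (pderiv i r)) := by
    rw [← cprod_const_left, act_cprod (by simp), act_const_of_equivariant b he, cprod_neg_left,
      lieD, cprod_sum_left, cprod_const_left]
    simp only [cprod_mulLin_left]
    abel
  have h2 (j : Fin n) : cprod (TensorProduct.mk ℂ 𝔤 (𝔤 ⊗[ℂ] 𝔤)) (pderiv j χ)
      (mapVal (LieModule.toEnd ℂ 𝔤 (𝔤 ⊗[ℂ] 𝔤) (b j : 𝔤)) r) =
      -∑ i, mulLin b ⁅b j, b i⁆ (cprod (TensorProduct.mk ℂ 𝔤 (𝔤 ⊗[ℂ] 𝔤)) (pderiv j χ)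
        (pderiv i r)) := by
    rw [isEquivariant_iff] at hr
    rw [hr, lieD, cprod_sum, ← Finset.sum_neg_distrib]
    simp only [cprod_mulLin, ← neg_mulLin, lie_skew]
  simp only [dBar, act_sum, h1, h2, Finset.sum_sub_distrib, Finset.sum_neg_distrib]
  rw [Finset.sum_comm]
  simp only [act_eq_cprod, pderiv_cprod, mapVal_add, Finset.sum_add_distrib]
  abel

/-- Infinitesimal gauge covariance of the dynamical Yang–Baxter equation. -/
theorem cdybe_deriv (he : IsEquivariant b χ) {r : FormalFun n (𝔤 ⊗[ℂ] 𝔤)}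
    (hr : IsEquivariant b r) :
    altD b (act χ r - gaugeShift b χ) +
      (cprod (cybBil 𝔤) (act χ r - gaugeShift b χ) r +
        cprod (cybBil 𝔤) r (act χ r - gaugeShift b χ)) =
      act χ (altD b r + cprod (cybBil 𝔤) r r) := by
  -- The defect of `dBar_act` is the polarized Yang–Baxter operator at the shift: `cybBil_polarized`
  -- with a = xᵢ and c = ∂ᵢχ.
  have h : ∑ i, mapVal (Alt 𝔤) (mapVal (TensorProduct.mk ℂ 𝔤 (𝔤 ⊗[ℂ] 𝔤) (b i : 𝔤))
        (act (pderiv i χ) r) -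
      cprod (TensorProduct.mk ℂ 𝔤 (𝔤 ⊗[ℂ] 𝔤)) (pderiv i χ)
        (mapVal (LieModule.toEnd ℂ 𝔤 (𝔤 ⊗[ℂ] 𝔤) (b i : 𝔤)) r)) =
      cprod (cybBil 𝔤) (gaugeShift b χ) r + cprod (cybBil 𝔤) r (gaugeShift b χ) := by
    rw [cprod_flip (cybBil 𝔤) r, gaugeShift, dBar, mapVal_sum, ← Finset.sum_sub_distrib,
      cprod_sum_left, cprod_sum_left, ← Finset.sum_add_distrib]
    refine Finset.sum_congr rfl fun i _ => ?_
    ext d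
    simp only [mapVal, act, cprod, Pi.sub_apply, Pi.add_apply, map_sub, map_sum,
      ← Finset.sum_sub_distrib, ← Finset.sum_add_distrib]
    refine Finset.sum_congr rfl fun p _ => ?_
    rw [← map_sub (cybBil 𝔤), ← map_sub (cybBil 𝔤).flip]
    exact (cybBil_polarized (b i : 𝔤) (pderiv i χ p.1) (r p.2)).symm
  rw [altD_sub, altD_gaugeShift, altD_eq, dBar_act b he hr, mapVal_add, mapVal_sum, h,
    mapVal_act (𝔤 := 𝔤) (L := Alt 𝔤) Alt_lie, cprod_sub, cprod_sub_left, act_add,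
    act_cprod (𝔤 := 𝔤) (B := cybBil 𝔤) lie_cybBil, altD_eq]
  abel

/-- Gauge transforms of dynamical r-matrices are dynamical r-matrices. -/
theorem IsDynR.gaugeTransform [FiniteDimensional ℂ 𝔤] (hχ : χ 0 = 0) (he : IsEquivariant b χ)
    {Ω : 𝔤 ⊗[ℂ] 𝔤} (hΩ : ∀ x : 𝔤, ⁅x, Ω⁆ = 0) {r : FormalFun n (𝔤 ⊗[ℂ] 𝔤)} (hr : IsDynR b Ω r) :
    IsDynR b Ω (gaugeTransform b χ r) := by
  have hR := hasCoeffDeriv_gaugeTransform b hχ he r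
  have h0 : DynR.gaugeTransform b ((0 : ℂ) • χ) r = r := by rw [zero_smul, gaugeTransform_zero]
  set R := fun t : ℂ => DynR.gaugeTransform b (t • χ) r with hRdef
  have h0 : R 0 = r := h0
  -- Each of the three conditions is the vanishing of a curve E with E' = χ·E and E(0) = 0.
  have heq (t : ℂ) : IsEquivariant b (R t) := by
    rw [isEquivariant_iff]
    intro y
    rw [← sub_eq_zero]
    refine HasCoeffDeriv.eq_zero hχ (E := fun t => mapVal _ (R t) - lieD b y (R t))
      (((hR.mapVal _).sub (hR.lieD b y)).congr fun t => ?_) ?_ t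
    · have h1 := (isEquivariant_iff b).1 (he.gaugeShift b) y
      have h2 : mapVal (LieModule.toEnd ℂ 𝔤 (𝔤 ⊗[ℂ] 𝔤) (y : 𝔤)) (act χ (R t)) =
          act (mapVal (LieModule.toEnd ℂ 𝔤 𝔤 (y : 𝔤)) χ) (R t) +
          act χ (mapVal (LieModule.toEnd ℂ 𝔤 (𝔤 ⊗[ℂ] 𝔤) (y : 𝔤)) (R t)) := by
        ext d
        simp [mapVal, act, cprod]
      have h3 : lieD b y (act χ (R t)) = act (lieD b y χ) (R t) + act χ (lieD b y (R t)) :=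
        lieD_cprod _ _ _ _ _
      rw [mapVal_sub, lieD_sub, h1, h2, h3, (isEquivariant_iff b).1 he y, act_sub]
      abel
    · simp only [h0]
      rw [(isEquivariant_iff b).1 hr.equivariant y, sub_self]
  have hqu (t : ℂ) : R t + mapVal (flip21 𝔤) (R t) - const n Ω = 0 := by
    refine HasCoeffDeriv.eq_zero hχ (E := fun t => R t + mapVal (flip21 𝔤) (R t) - const n Ω)
      (((hR.add (hR.mapVal _)).sub (HasCoeffDeriv.const _)).congr fun t => ?_) ?_ t
    · rw [mapVal_sub, mapVal_flip21_gaugeShift, act_sub, act_add, act_const_eq_zero hΩ,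
        mapVal_act flip21_lie]
      abel
    · simp only [h0]
      rw [hr.quasiUnitary, sub_self]
  -- The linear equation for this defect uses the equivariance of `R t` for every t, hence the order
  -- of the three claims.
  have hcy (t : ℂ) : altD b (R t) + cprod (cybBil 𝔤) (R t) (R t) = 0 := by
    refine HasCoeffDeriv.eq_zero hχ
      (E := fun t => altD b (R t) + cprod (cybBil 𝔤) (R t) (R t))
      ((((hR.dBar b).mapVal (Alt 𝔤)).add (hR.cprod (cybBil 𝔤) hR)).congr fun t => ?_) ?_ t
    · exact cdybe_deriv b he (heq t)
    · simp only [h0]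
      rw [← CYBFun_eq, hr.cdybe]
  have h1 : R 1 = DynR.gaugeTransform b χ r := by simp only [hRdef, one_smul]
  rw [← h1]
  exact ⟨heq 1, by rw [CYBFun_eq, hcy], by rw [← sub_eq_zero, hqu]⟩

end Preservation

/-! ### Congruences modulo terms of high degree -/

section Congruence

variable {n : ℕ} {U V W : Type*}

/-- The coefficients of `f` and `g` agree in all degrees below `m`. -/
def EqMod (m : ℕ) (f g : FormalFun n V) : Prop := ∀ d : Fin n →₀ ℕ, d.degree < m → f d = g d

namespace EqMod

variable {m k : ℕ}

section

variable {f g h : FormalFun n V}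

theorem refl (m : ℕ) (f : FormalFun n V) : EqMod m f f := fun _ _ => rfl
theorem trans (h₁ : EqMod m f g) (h₂ : EqMod m g h) : EqMod m f h :=
  fun d hd => (h₁ d hd).trans (h₂ d hd)
theorem mono (h : EqMod m f g) (hk : k ≤ m) : EqMod k f g := fun d hd => h d (hd.trans_le hk)

end

variable [AddCommGroup U] [AddCommGroup V] [AddCommGroup W] {f f' g g' : FormalFun n V}

theorem add (h : EqMod m f g) (h' : EqMod m f' g') : EqMod m (f + f') (g + g') :=
  fun d hd => by rw [Pi.add_apply, Pi.add_apply, h d hd, h' d hd]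
theorem sub (h : EqMod m f g) (h' : EqMod m f' g') : EqMod m (f - f') (g - g') :=
  fun d hd => by rw [Pi.sub_apply, Pi.sub_apply, h d hd, h' d hd]
theorem sum {ι : Type*} {s : Finset ι} {f g : ι → FormalFun n V}
    (h : ∀ i ∈ s, EqMod m (f i) (g i)) : EqMod m (∑ i ∈ s, f i) (∑ i ∈ s, g i) :=
  fun d hd => by
    rw [Finset.sum_apply, Finset.sum_apply]
    exact Finset.sum_congr rfl fun i hi => h i hi d hd

variable [Module ℂ U] [Module ℂ V] [Module ℂ W]

theorem mapVal (L : V →ₗ[ℂ] W) (h : EqMod m f g) : EqMod m (mapVal L f) (DynR.mapVal L g) :=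
  fun d hd => congrArg L (h d hd)
theorem pderiv (i : Fin n) (h : EqMod (m + 1) f g) : EqMod m (pderiv i f) (DynR.pderiv i g) :=
  fun d hd => by
    rw [DynR.pderiv, DynR.pderiv, h _ (by simpa using hd)]

theorem cprod (B : U →ₗ[ℂ] V →ₗ[ℂ] W) {f f' : FormalFun n U} {g g' : FormalFun n V}
    (h : EqMod m f f') (h' : EqMod m g g') : EqMod m (cprod B f g) (DynR.cprod B f' g') :=
  fun d hd => Finset.sum_congr rfl fun p hp => by
    have h2 : p.1.degree + p.2.degree = d.degree := by
      rw [← map_add, mem_antidiagonal.mp hp]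
    rw [h p.1 (by omega), h' p.2 (by omega)]

/-- A factor that vanishes at the origin gains one order of agreement. -/
theorem cprod_succ (B : U →ₗ[ℂ] V →ₗ[ℂ] W) {f : FormalFun n U} (hf : f 0 = 0)
    {g g' : FormalFun n V} (h : EqMod m g g') :
    EqMod (m + 1) (DynR.cprod B f g) (DynR.cprod B f g') :=
  fun d hd => Finset.sum_congr rfl fun p hp => by
    have h2 : p.1.degree + p.2.degree = d.degree := by
      rw [← map_add, mem_antidiagonal.mp hp]
    by_cases h0 : p.1 = 0
    · simp [h0, hf]
    · have h1 : p.1.degree ≠ 0 := by simpa [Finsupp.degree_eq_zero_iff] using h0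
      rw [h p.2 (by omega)]

end EqMod

end Congruence

/-! ### Dependence of the gauge transform on the lowest terms of χ -/

section GaugeCongruence

variable {𝔤 : Type*} [LieRing 𝔤] [LieAlgebra ℂ 𝔤] {𝔩 : LieSubalgebra ℂ 𝔤} {n : ℕ}
  (b : Module.Basis (Fin n) ℂ 𝔩) {χ χ' : FormalFun n 𝔤} {m k : ℕ}
variable {V : Type*} [AddCommGroup V] [Module ℂ V]

theorem EqMod.mulLin (y : 𝔩) {f g : FormalFun n V} (h : EqMod m f g) :
    EqMod (m + 1) (mulLin b y f) (DynR.mulLin b y g) :=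
  EqMod.cprod_succ _ (linFun_zero b y) h

theorem EqMod.lieD (y : 𝔩) {f g : FormalFun n V} (h : EqMod (m + 1) f g) :
    EqMod (m + 1) (lieD b y f) (DynR.lieD b y g) :=
  EqMod.sum fun i _ => (h.pderiv i).mulLin b _

theorem EqMod.dBar {f g : FormalFun n V} (h : EqMod (m + 1) f g) :
    EqMod m (dBar b f) (DynR.dBar b g) :=
  EqMod.sum fun i _ => (h.pderiv i).mapVal _

theorem EqMod.gaugeShift (h : EqMod (m + 1) χ χ') :
    EqMod m (gaugeShift b χ) (DynR.gaugeShift b χ') :=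
  (h.dBar b).sub ((h.dBar b).mapVal _)

variable [LieRingModule 𝔤 V] [LieModule ℂ 𝔤 V]

theorem EqMod.adSeries {f g : FormalFun n V} (h : EqMod m χ χ') (h' : EqMod m f g)
    (c : ℕ → ℂ) : EqMod m (adSeries c χ f) (DynR.adSeries c χ' g) := by
  have hk (k : ℕ) : EqMod m ((act χ)^[k] f) ((act χ')^[k] g) := by
    induction k with
    | zero => exact h'
    | succ k ih =>
      rw [Function.iterate_succ_apply', Function.iterate_succ_apply']
      exact h.cprod _ ih
  exact fun d hd => Finset.sum_congr rfl fun k _ => by rw [hk k d hd]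

/-- Every term with k ≥ 1 gains a degree from χ, so only the coefficient `c 0` is visible. -/
theorem EqMod.adSeries_of_eqMod_zero (hχ : χ 0 = 0) {f : FormalFun n V} (h : EqMod m f 0)
    (c : ℕ → ℂ) : EqMod (m + 1) (DynR.adSeries c χ f) (c 0 • f) := by
  have hk (k : ℕ) : EqMod (m + 1) ((act χ)^[k + 1] f) 0 := by
    induction k with
    | zero =>
      have := h.cprod_succ (LieModule.toEnd ℂ 𝔤 V : 𝔤 →ₗ[ℂ] Module.End ℂ V) hχ
      rwa [cprod_zero] at this
    | succ k ih =>
      rw [Function.iterate_succ_apply']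
      have := (EqMod.refl (m + 1) χ).cprod (LieModule.toEnd ℂ 𝔤 V : 𝔤 →ₗ[ℂ] Module.End ℂ V) ih
      rwa [cprod_zero] at this
  intro d hd
  rw [DynR.adSeries, Finset.sum_range_succ', Finset.sum_eq_zero, zero_add]
  · rfl
  · intro k _
    rw [hk k d hd, Pi.zero_apply, smul_zero]

theorem etaComp_eqMod (hχ' : χ' 0 = 0) (h : EqMod (k + 1) χ' χ) (i : Fin n) :
    EqMod (k + 1) (etaComp χ' i) (etaComp χ i + pderiv i (χ' - χ)) := by
  have h0 : EqMod (k + 1) (χ' - χ) 0 := by simpa using h.sub (EqMod.refl _ χ)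
  have h1 : pderiv i χ' = pderiv i χ + pderiv i (χ' - χ) := by rw [pderiv_sub]; abel
  have h2 : EqMod k (pderiv i (χ' - χ)) 0 := by simpa [pderiv_zero] using h0.pderiv i
  rw [etaComp, h1, adSeries_add]
  refine (h.adSeries (EqMod.refl _ _) _).add ?_
  simpa using EqMod.adSeries_of_eqMod_zero hχ' h2
    (fun k => (-1) ^ k * (((k + 1).factorial : ℂ))⁻¹)

/-- First variation of the gauge transform in the lowest degree. -/
theorem gaugeTransform_eqMod (hχ' : χ' 0 = 0) (h : EqMod (k + 1) χ' χ)
    (r : FormalFun n (𝔤 ⊗[ℂ] 𝔤)) : EqMod (k + 1) (gaugeTransform b χ' r)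
      (gaugeTransform b χ r - gaugeShift b (χ' - χ)) := by
  have h0 : EqMod (k + 1) (χ' - χ) 0 := by simpa using h.sub (EqMod.refl _ χ)
  have hs : EqMod k (gaugeShift b (χ' - χ)) 0 := by
    have : gaugeShift b (0 : FormalFun n 𝔤) = 0 := by
      simp [gaugeShift, dBar, pderiv_zero, mapVal_zero]
    simpa [this] using h0.gaugeShift b
  have hη := etaComp_eqMod hχ' h
  have hη' (i : Fin n) : EqMod k (etaComp χ' i) (etaComp χ i) := by
    refine ((hη i).mono k.le_succ).trans ?_
    simpa [pderiv_zero] using (EqMod.refl k (etaComp χ i)).add (h0.pderiv i)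
  have hb : EqMod (k + 1) (etaBar b χ') (etaBar b χ + dBar b (χ' - χ)) := by
    rw [etaBar, etaBar, dBar, ← Finset.sum_add_distrib]
    refine EqMod.sum fun i _ => ?_
    rw [← mapVal_add]
    exact (hη i).mapVal _
  -- The components of η agree only below degree k, but the linear factor [xᵢ, xⱼ] recovers the lost
  -- degree.
  have hz : EqMod (k + 1) (zetaContr b χ') (zetaContr b χ) :=
    EqMod.sum fun i _ => EqMod.sum fun j _ => ((hη' i).cprod _ (hη' j)).mulLin b _
  have key : EqMod (k + 1)
      (r - etaBar b χ' + mapVal (flip21 𝔤) (etaBar b χ') - zetaContr b χ')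
      (r - etaBar b χ + mapVal (flip21 𝔤) (etaBar b χ) - zetaContr b χ -
        gaugeShift b (χ' - χ)) := by
    refine ((((EqMod.refl _ r).sub hb).add (hb.mapVal _)).sub hz).trans ?_
    rw [mapVal_add, gaugeShift]
    intro d _
    simp only [Pi.sub_apply, Pi.add_apply]
    abel
  refine ((EqMod.refl _ χ').adSeries key _).trans ?_
  rw [adSeries_sub]
  refine (h.adSeries (EqMod.refl _ _) _).sub ?_
  simpa using EqMod.adSeries_of_eqMod_zero hχ' hs (fun k => ((k.factorial : ℂ))⁻¹)

/-- Equivariance in degree d involves coefficients of f in degrees up to |d| only, so it passes to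
adic limits. -/
theorem isEquivariant_of_eqMod {f : FormalFun n V}
    (h : ∀ m, ∃ g, IsEquivariant b g ∧ EqMod m f g) : IsEquivariant b f := by
  rw [isEquivariant_iff]
  intro y
  ext d
  obtain ⟨g, hg, hfg⟩ := h (d.degree + 1)
  rw [isEquivariant_iff] at hg
  rw [hfg.lieD b y d (Nat.lt_succ_self _), ← hg y]
  exact hfg.mapVal _ d (Nat.lt_succ_self _)

end GaugeCongruence

/-! ### The Poincaré homotopy -/

section Weights

variable {n : ℕ} {V W : Type*} [AddCommGroup V] [Module ℂ V] [AddCommGroup W] [Module ℂ W]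

/-- Multiply the terms of degree `k` by `c k`. -/
def weight (c : ℕ → ℂ) (f : FormalFun n V) : FormalFun n V := fun d => c d.degree • f d

theorem pderiv_weight (c : ℕ → ℂ) (i : Fin n) (f : FormalFun n V) :
    pderiv i (weight c f) = weight (fun k => c (k + 1)) (pderiv i f) := by
  ext d
  simp [pderiv, weight, smul_comm (c _)]

theorem mapVal_weight (L : V →ₗ[ℂ] W) (c : ℕ → ℂ) (f : FormalFun n V) :
    mapVal L (weight c f) = weight c (mapVal L f) := by
  ext d
  simp [mapVal, weight]

variable {𝔤 : Type*} [LieRing 𝔤] [LieAlgebra ℂ 𝔤] {𝔩 : LieSubalgebra ℂ 𝔤}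
  (b : Module.Basis (Fin n) ℂ 𝔩)

theorem mulLin_weight (c : ℕ → ℂ) (y : 𝔩) (f : FormalFun n V) :
    mulLin b y (weight (fun k => c (k + 1)) f) = weight c (mulLin b y f) := by
  ext d
  simp only [mulLin, weight, cprod, Finset.smul_sum, LinearMap.lsmul_apply]
  refine Finset.sum_congr rfl fun p hp => ?_
  have h2 : p.1.degree + p.2.degree = d.degree := by
    rw [← map_add, mem_antidiagonal.mp hp]
  by_cases h : p.1.degree = 1
  · rw [smul_comm, ← h2, h, add_comm]
  · have : linFun b y p.1 = 0 := by
      rw [linFun, Finset.sum_apply]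
      refine Finset.sum_eq_zero fun i _ => Pi.single_eq_of_ne ?_ _
      intro h'
      exact h (by rw [h']; simp)
    simp [this]

/-- The vector field has linear coefficients and so preserves degree; the weights therefore keep the
homotopy equivariant. -/
theorem lieD_weight (c : ℕ → ℂ) (y : 𝔩) (f : FormalFun n V) :
    lieD b y (weight c f) = weight c (lieD b y f) := by
  have h (g : Fin n → FormalFun n V) : weight c (∑ i, g i) = ∑ i, weight c (g i) := by
    ext d; simp [weight, Finset.smul_sum]
  simp only [lieD, pderiv_weight, mulLin_weight, h]

theorem dBar_weight (c : ℕ → ℂ) (f : FormalFun n V) :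
    dBar b (weight c f) = weight (fun k => c (k + 1)) (dBar b f) := by
  ext d
  simp [dBar, weight, Finset.smul_sum, pderiv_weight, mapVal]

theorem dBar_mapVal (L : V →ₗ[ℂ] W) (f : FormalFun n V) :
    dBar b (mapVal L f) = mapVal (TensorProduct.map LinearMap.id L) (dBar b f) := by
  ext d
  simp [dBar, pderiv_mapVal, mapVal]

theorem linFun_basis (j : Fin n) : linFun b (b j) = Pi.single (Finsupp.single j 1) 1 := by
  rw [linFun, Finset.sum_eq_single j]
  · simp
  · intro i _ hi
    simp [Ne.symm hi]
  · simp

/-- Euler's formula. -/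
theorem sum_mulLin_pderiv (f : FormalFun n V) :
    ∑ j, mulLin b (b j) (pderiv j f) = weight (fun k => (k : ℂ)) f := by
  have key (j : Fin n) (d : Fin n →₀ ℕ) :
      mulLin b (b j) (pderiv j f) d = (d j : ℂ) • f d := by
    rw [mulLin, cprod, linFun_basis]
    by_cases hd : d j = 0
    · rw [hd, Nat.cast_zero, zero_smul]
      refine Finset.sum_eq_zero fun p hp => ?_
      have h1 := DFunLike.congr_fun (mem_antidiagonal.mp hp) j
      have : p.1 ≠ Finsupp.single j 1 := by
        intro h'
        rw [Finsupp.add_apply, h', Finsupp.single_eq_same] at h1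
        omega
      simp [Pi.single_eq_of_ne this]
    · have hle : Finsupp.single j 1 ≤ d := by
        simpa [Finsupp.single_le_iff] using Nat.one_le_iff_ne_zero.mpr hd
      rw [Finset.sum_eq_single (Finsupp.single j 1, d - Finsupp.single j 1)]
      · have : ((d j - 1 : ℕ) : ℂ) + 1 = d j := by
          rw [Nat.cast_sub (Nat.one_le_iff_ne_zero.mpr hd)]; simp
        simp [pderiv, tsub_add_cancel_of_le hle, this]
      · rintro ⟨p, q⟩ hp hne
        have h1 : p + q = d := mem_antidiagonal.mp hp
        have : p ≠ Finsupp.single j 1 := by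
          rintro rfl
          exact hne (by rw [← h1, add_tsub_cancel_left])
        simp [Pi.single_eq_of_ne this]
      · intro h
        exact absurd (mem_antidiagonal.mpr (add_tsub_cancel_of_le hle)) h
  ext d
  rw [Finset.sum_apply]
  simp only [key, ← Finset.sum_smul, weight, Finsupp.degree_eq_sum, Nat.cast_sum]

end Weights

/-! ### Contraction with the Euler field and inversion of the shift -/

section Homotopy

variable {𝔤 : Type*} [LieRing 𝔤] [LieAlgebra ℂ 𝔤] {𝔩 : LieSubalgebra ℂ 𝔤} {n : ℕ}
  (b : Module.Basis (Fin n) ℂ 𝔩) (P : 𝔤 →ₗ[ℂ] 𝔩)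
variable {W : Type*} [AddCommGroup W] [Module ℂ W]

/-- The contraction `a ⊗ w ↦ (P a)ⱼ w`. -/
def contr (W : Type*) [AddCommGroup W] [Module ℂ W] (j : Fin n) : (𝔤 ⊗[ℂ] W) →ₗ[ℂ] W :=
  TensorProduct.lift (LinearMap.lsmul ℂ W ∘ₗ b.coord j ∘ₗ P)

theorem contr_tmul (j : Fin n) (a : 𝔤) (w : W) : contr b P W j (a ⊗ₜ w) = b.repr (P a) j • w := rfl

/-- The contraction of the first tensor factor with the Euler vector field. -/
def eulerContr (f : FormalFun n (𝔤 ⊗[ℂ] W)) : FormalFun n W :=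
  ∑ j, mulLin b (b j) (mapVal (contr b P W j) f)

/-- The projection to `𝔩` as an endomorphism of `𝔤`. -/
def endProj : 𝔤 →ₗ[ℂ] 𝔤 := 𝔩.toSubmodule.subtype ∘ₗ P

theorem sum_tmul_contr (v : 𝔤 ⊗[ℂ] W) :
    ∑ i, (b i : 𝔤) ⊗ₜ contr b P W i v = TensorProduct.map (endProj P) LinearMap.id v := by
  induction v with
  | zero => simp
  | add v w hv hw => simp [TensorProduct.tmul_add, Finset.sum_add_distrib, hv, hw]
  | tmul a w =>
    have := congrArg (fun z : 𝔩 => (z : 𝔤)) (b.sum_repr (P a))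
    simp only [AddSubmonoidClass.coe_finsetSum, SetLike.val_smul] at this
    simp only [contr_tmul, ← TensorProduct.smul_tmul, ← TensorProduct.sum_tmul, this]
    rfl

/-- The first slot of Alt(xᵢ ⊗ a ⊗ c) holds xᵢ once and a twice; the two terms with a form x ⊗ c
minus its flip. This is the pointwise core of Cartan's formula. -/
theorem contr_Alt {P : 𝔤 →ₗ[ℂ] 𝔩} (hP : ∀ x : 𝔩, P x = x) (i j : Fin n) (v : 𝔤 ⊗[ℂ] 𝔤) :
    contr b P (𝔤 ⊗[ℂ] 𝔤) j (Alt 𝔤 ((b i : 𝔤) ⊗ₜ v)) = (if i = j then v else 0) -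
      ((b i : 𝔤) ⊗ₜ contr b P 𝔤 j v - flip21 𝔤 ((b i : 𝔤) ⊗ₜ contr b P 𝔤 j v)) := by
  induction v with
  | zero => simp
  | add v w hv hw =>
    simp only [TensorProduct.tmul_add, map_add, hv, hw]
    split_ifs <;> abel
  | tmul a c =>
    simp only [Alt_tmul, map_add, map_sub, contr_tmul, hP, flip21, b.repr_self,
      TensorProduct.tmul_smul, map_smul, LinearEquiv.coe_coe, TensorProduct.comm_tmul,
      Finsupp.single_apply]
    split_ifs <;> simp <;> abel

theorem mapVal_contr_altD {P : 𝔤 →ₗ[ℂ] 𝔩} (hP : ∀ x : 𝔩, P x = x) (j : Fin n)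
    (f : FormalFun n (𝔤 ⊗[ℂ] 𝔤)) :
    mapVal (contr b P (𝔤 ⊗[ℂ] 𝔤) j) (altD b f) =
      pderiv j f - (dBar b (mapVal (contr b P 𝔤 j) f) -
        mapVal (flip21 𝔤) (dBar b (mapVal (contr b P 𝔤 j) f))) := by
  ext d
  simp [altD, dBar, mapVal_apply, contr_Alt b hP, pderiv_mapVal, Finset.sum_sub_distrib]

/-- Differentiating the coordinate coefficients rebuilds the projection of the first factor to 𝔩;
this term, with its flip, shifts the eigenvalue k to k+1 and k+2. -/
theorem dBar_eulerContr (f : FormalFun n (𝔤 ⊗[ℂ] W)) :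
    dBar b (eulerContr b P f) = mapVal (TensorProduct.map (endProj P) LinearMap.id) f +
      ∑ j, mulLin b (b j) (dBar b (mapVal (contr b P W j) f)) := by
  have h : mapVal (TensorProduct.map (endProj P) LinearMap.id) f =
      ∑ i, mapVal (TensorProduct.mk ℂ 𝔤 W (b i : 𝔤)) (mapVal (contr b P W i) f) := by
    ext d
    simp [mapVal_apply, sum_tmul_contr]
  rw [h, dBar, eulerContr]
  simp only [dBar, pderiv_sum, pderiv_mulLin, mulLin_sum, mapVal_sum, mapVal_add, mapVal_mulLin,
    Finset.sum_add_distrib, mapVal_smul]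
  congr 1
  · refine Finset.sum_congr rfl fun i _ => ?_
    rw [Finset.sum_eq_single i]
    · simp
    · intro j _ hj
      simp [hj]
    · simp
  · exact Finset.sum_comm

/-- Cartan's formula for the differential `Alt(dρ)` and the contraction with the Euler field. -/
theorem gaugeShift_eulerContr {P : 𝔤 →ₗ[ℂ] 𝔩} (hP : ∀ x : 𝔩, P x = x)
    {f : FormalFun n (𝔤 ⊗[ℂ] 𝔤)} (hf : mapVal (flip21 𝔤) f = -f) :
    gaugeShift b (eulerContr b P f) = weight (fun k => (k : ℂ)) f +
      mapVal (TensorProduct.map (endProj P) LinearMap.id) f +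
      mapVal (TensorProduct.map LinearMap.id (endProj P)) f - eulerContr b P (altD b f) := by
  have h1 : mapVal (flip21 𝔤) (mapVal (TensorProduct.map (endProj P) LinearMap.id) f) =
      -mapVal (TensorProduct.map LinearMap.id (endProj P)) f := by
    rw [← mapVal_neg, ← hf]
    ext d
    exact (LinearMap.congr_fun (TensorProduct.map_comp_comm_eq _ _) _).symm
  rw [gaugeShift, dBar_eulerContr, mapVal_add, h1, eulerContr]
  simp only [mapVal_contr_altD b hP, mulLin_sub, Finset.sum_sub_distrib, sum_mulLin_pderiv,
    mapVal_sum, mapVal_mulLin]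
  abel

/-- The single contractions transform by the coadjoint matrix of y, and the Lie derivative of the
coordinates xⱼ compensates for it: the Euler field is invariant. -/
theorem isEquivariant_eulerContr {P : 𝔤 →ₗ[ℂ] 𝔩}
    (hPe : ∀ (y : 𝔩) (a : 𝔤), P ⁅(y : 𝔤), a⁆ = ⁅y, P a⁆) [LieRingModule 𝔤 W] [LieModule ℂ 𝔤 W]
    {f : FormalFun n (𝔤 ⊗[ℂ] W)} (hf : IsEquivariant b f) :
    IsEquivariant b (eulerContr b P f) := by
  rw [isEquivariant_iff] at *
  intro y
  have key (j : Fin n) (v : 𝔤 ⊗[ℂ] W) : ⁅(y : 𝔤), contr b P W j v⁆ =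
      contr b P W j ⁅(y : 𝔤), v⁆ - ∑ k, b.repr ⁅y, b k⁆ j • contr b P W k v := by
    induction v with
    | zero => simp
    | add v w hv hw =>
      simp only [map_add, lie_add, hv, hw, smul_add, Finset.sum_add_distrib]; abel
    | tmul a w =>
      have : ⁅y, P a⁆ = ∑ k, b.repr (P a) k • ⁅y, b k⁆ := by
        conv_lhs => rw [← b.sum_repr (P a), lie_sum]
        simp
      simp only [TensorProduct.LieModule.lie_tmul_right, map_add, contr_tmul, hPe, this, map_sum,
        map_smul, Finsupp.coe_finsetSum, Finset.sum_apply, Finsupp.smul_apply, Finset.sum_smul,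
        smul_smul, smul_eq_mul, lie_smul, mul_comm]
      abel
  have h1 (j : Fin n) : mapVal (LieModule.toEnd ℂ 𝔤 W (y : 𝔤)) (mapVal (contr b P W j) f) =
      lieD b y (mapVal (contr b P W j) f) -
        ∑ k, b.repr ⁅y, b k⁆ j • mapVal (contr b P W k) f := by
    rw [← mapVal_lieD, ← hf]
    ext d
    simpa [mapVal_apply] using key j (f d)
  rw [eulerContr, mapVal_sum, lieD_sum]
  simp only [mapVal_mulLin, h1, mulLin_sub, mulLin_sum, mulLin_smul, lieD_mulLin,
    Finset.sum_sub_distrib, Finset.sum_add_distrib]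
  rw [Finset.sum_comm]
  simp only [← smul_mulLin, ← sum_mulLin, b.sum_repr]
  rw [add_comm, sub_eq_add_neg, ← Finset.sum_neg_distrib]
  simp only [← neg_mulLin, lie_skew]

/-- The homotopy operator which inverts `gaugeShift`. -/
def homotopy (f : FormalFun n (𝔤 ⊗[ℂ] 𝔤)) : FormalFun n 𝔤 :=
  weight (fun k => ((k : ℂ) + 1)⁻¹) (mapVal (endProj P) (eulerContr b P f)) +
    weight (fun k => (k : ℂ)⁻¹) (mapVal (LinearMap.id - endProj P) (eulerContr b P f))

theorem isEquivariant_homotopy {P : 𝔤 →ₗ[ℂ] 𝔩}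
    (hPe : ∀ (y : 𝔩) (a : 𝔤), P ⁅(y : 𝔤), a⁆ = ⁅y, P a⁆)
    {f : FormalFun n (𝔤 ⊗[ℂ] 𝔤)} (hf : IsEquivariant b f) :
    IsEquivariant b (homotopy b P f) := by
  have h := isEquivariant_eulerContr b hPe hf
  have h1 := (isEquivariant_iff b).1 (h.mapVal b (L := endProj P) fun y v => by
    simp [endProj, hPe])
  have h2 := (isEquivariant_iff b).1 (h.mapVal b (L := LinearMap.id - endProj P) fun y v => by
    simp [endProj, hPe])
  rw [isEquivariant_iff]
  intro y
  rw [homotopy, mapVal_add, mapVal_weight, mapVal_weight, lieD_add, lieD_weight, lieD_weight,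
    h1, h2]

theorem endProj_comp {P : 𝔤 →ₗ[ℂ] 𝔩} (hP : ∀ x : 𝔩, P x = x) :
    endProj P ∘ₗ endProj P = endProj P := by
  ext a; simp [endProj, hP]

open TensorProduct in
/-- The inversion of `gaugeShift` in a single degree. -/
theorem sub_flip21_eq {p : 𝔤 →ₗ[ℂ] 𝔤} (hp : p ∘ₗ p = p) (k : ℕ) {z v : 𝔤 ⊗[ℂ] 𝔤}
    (hz : map p LinearMap.id z = z) (hv : flip21 𝔤 v = -v)
    (h : z - flip21 𝔤 z = (k : ℂ) • v + map p LinearMap.id v + map LinearMap.id p v) :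
    ((((k : ℂ) + 2)⁻¹ • map LinearMap.id p z +
        ((k : ℂ) + 1)⁻¹ • map LinearMap.id (LinearMap.id - p) z) -
      flip21 𝔤 (((k : ℂ) + 2)⁻¹ • map LinearMap.id p z +
        ((k : ℂ) + 1)⁻¹ • map LinearMap.id (LinearMap.id - p) z) =
      v - map (LinearMap.id - p) (LinearMap.id - p) v) ∧
    (k : ℂ) • map (LinearMap.id - p) (LinearMap.id - p) v = 0 := by
  set q := LinearMap.id - p with hq
  have hqp : q ∘ₗ p = 0 := by rw [hq, LinearMap.sub_comp, hp]; simp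
  have mm (f g f' g' : 𝔤 →ₗ[ℂ] 𝔤) (w : 𝔤 ⊗[ℂ] 𝔤) :
      map f g (map f' g' w) = map (f ∘ₗ f') (g ∘ₗ g') w := by rw [map_comp]; rfl
  have mf (f g : 𝔤 →ₗ[ℂ] 𝔤) (w : 𝔤 ⊗[ℂ] 𝔤) : map f g (flip21 𝔤 w) = flip21 𝔤 (map g f w) :=
    LinearMap.congr_fun (map_comp_comm_eq _ _) _
  -- Splitting both factors by p and q, the first factor of z lies in the image of p. The equation
  -- then reads z_pp - z_pp²¹ = (k+2) v_pp, z_pq = (k+1) v_pq and 0 = k v_qq, which dictates the two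
  -- weights.
  have h11 := congrArg (map p p) h
  have h12 := congrArg (map p q) h
  have h22 := congrArg (map q q) h
  have e1 : map p p z = map LinearMap.id p z := by
    conv_rhs => rw [← hz]
    rw [mm]; simp
  have e2 : map p q z = map LinearMap.id q z := by
    conv_rhs => rw [← hz]
    rw [mm]; simp
  have e3 (f : 𝔤 →ₗ[ℂ] 𝔤) : map q f z = 0 := by
    conv_lhs => rw [← hz]
    rw [mm, hqp]; simp
  have hv' : flip21 𝔤 (map p q v) = -map q p v := by rw [← mf, hv, map_neg]
  simp only [map_sub, map_add, map_smul, mm, mf, hp, hqp, LinearMap.comp_id, e1, e2, e3,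
    map_zero, map_zero_left, map_zero_right, LinearMap.zero_apply, sub_zero, add_zero] at h11 h12 h22
  have hk2 : (k : ℂ) + 2 ≠ 0 := by exact_mod_cast (Nat.succ_ne_zero (k + 1))
  have hk1 : (k : ℂ) + 1 ≠ 0 := by exact_mod_cast (Nat.succ_ne_zero k)
  have hdec : v = map p p v + map p q v + map q p v + map q q v := by
    conv_lhs => rw [← LinearMap.id_apply (R := ℂ) v, ← map_id]
    have : (LinearMap.id : 𝔤 →ₗ[ℂ] 𝔤) = p + q := by rw [hq]; abel
    rw [this]
    simp only [map_add_left, map_add_right, LinearMap.add_apply]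
    abel
  refine ⟨?_, h22.symm⟩
  have h11' : map LinearMap.id p z - flip21 𝔤 (map LinearMap.id p z) =
      ((k : ℂ) + 2) • map p p v := by rw [h11]; module
  have h12' : map LinearMap.id q z = ((k : ℂ) + 1) • map p q v := by rw [h12]; module
  rw [map_add, map_smul, add_sub_add_comm, ← smul_sub, h11', h12', smul_smul, smul_smul,
    inv_mul_cancel₀ hk2, inv_mul_cancel₀ hk1, one_smul, one_smul, hv']
  rw [eq_sub_iff_add_eq]
  refine Eq.trans ?_ hdec.symm
  abel

/-- Cartan's formula is applied componentwise. The weights of `homotopy` at degree k+1 act on degree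
k here because differentiation lowers the degree. The second claim shows that the part not recovered
can survive only at the origin. -/
theorem gaugeShift_homotopy {P : 𝔤 →ₗ[ℂ] 𝔩} (hP : ∀ x : 𝔩, P x = x)
    {f : FormalFun n (𝔤 ⊗[ℂ] 𝔤)} (hf : mapVal (flip21 𝔤) f = -f) {d : Fin n →₀ ℕ}
    (hd : eulerContr b P (altD b f) d = 0) :
    gaugeShift b (homotopy b P f) d = f d -
      TensorProduct.map (LinearMap.id - endProj P) (LinearMap.id - endProj P) (f d) ∧
    (d.degree : ℂ) •
      TensorProduct.map (LinearMap.id - endProj P) (LinearMap.id - endProj P) (f d) = 0 := by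
  set z := dBar b (eulerContr b P f) d with hz
  have h1 : TensorProduct.map (endProj P) LinearMap.id z = z := by
    simp [hz, dBar, mapVal_apply, endProj, hP]
  have h2 := congrFun (gaugeShift_eulerContr b hP hf) d
  rw [Pi.sub_apply, hd, sub_zero] at h2
  have h3 : dBar b (homotopy b P f) d = (((d.degree : ℂ) + 2)⁻¹ •
      TensorProduct.map LinearMap.id (endProj P) z + ((d.degree : ℂ) + 1)⁻¹ •
      TensorProduct.map LinearMap.id (LinearMap.id - endProj P) z) := by
    rw [homotopy, dBar_add, dBar_weight, dBar_weight, dBar_mapVal, dBar_mapVal]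
    have : (d.degree : ℂ) + 1 + 1 = d.degree + 2 := by ring
    simp only [weight, Pi.add_apply, mapVal_apply, Nat.cast_add, Nat.cast_one, this, hz]
  rw [gaugeShift, Pi.sub_apply, mapVal_apply, h3]
  exact sub_flip21_eq (endProj_comp hP) d.degree h1 (congrFun hf d) h2

end Homotopy

/-! ### Gauge equivalence -/

section Convergence

variable {𝔤 : Type*} [LieRing 𝔤] [LieAlgebra ℂ 𝔤] {𝔩 : LieSubalgebra ℂ 𝔤} {n : ℕ}
  (b : Module.Basis (Fin n) ℂ 𝔩) {P : 𝔤 →ₗ[ℂ] 𝔩} {Ω : 𝔤 ⊗[ℂ] 𝔤}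

theorem EqMod.eulerContr {W : Type*} [AddCommGroup W] [Module ℂ W] {m : ℕ}
    {f g : FormalFun n (𝔤 ⊗[ℂ] W)} (h : EqMod m f g) :
    EqMod (m + 1) (eulerContr b P f) (DynR.eulerContr b P g) :=
  EqMod.sum fun _ _ => (h.mapVal _).mulLin b _

theorem eulerContr_zero {W : Type*} [AddCommGroup W] [Module ℂ W] :
    eulerContr b P (0 : FormalFun n (𝔤 ⊗[ℂ] W)) = 0 := by
  simp [eulerContr, mapVal_zero, mulLin_zero]

/-- The Euler field vanishes at the origin, so the contraction gains the degree that `gaugeShift`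
loses. -/
theorem homotopy_eqMod_zero {m : ℕ} {f : FormalFun n (𝔤 ⊗[ℂ] 𝔤)} (h : EqMod m f 0) :
    EqMod (m + 1) (homotopy b P f) 0 := by
  have h1 := h.eulerContr b (P := P)
  rw [eulerContr_zero] at h1
  intro d hd
  simp [homotopy, weight, mapVal_apply, h1 d hd]

theorem homotopy_apply_zero (f : FormalFun n (𝔤 ⊗[ℂ] 𝔤)) : homotopy b P f 0 = 0 :=
  homotopy_eqMod_zero b (m := 0) (fun _ hd => absurd hd (Nat.not_lt_zero _)) 0 (by simp)

theorem IsEquivariant.add {V : Type*} [AddCommGroup V] [Module ℂ V] [LieRingModule 𝔤 V]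
    [LieModule ℂ 𝔤 V] {f g : FormalFun n V} (hf : IsEquivariant b f) (hg : IsEquivariant b g) :
    IsEquivariant b (f + g) := by
  rw [isEquivariant_iff] at *
  intro y
  rw [mapVal_add, lieD_add, hf, hg]

theorem isEquivariant_const {V : Type*} [AddCommGroup V] [Module ℂ V] [LieRingModule 𝔤 V]
    [LieModule ℂ 𝔤 V] {v : V} (hv : ∀ y : 𝔩, ⁅(y : 𝔤), v⁆ = 0) : IsEquivariant b (const n v) := by
  rw [isEquivariant_iff]
  intro y
  rw [lieD_const, mapVal_const, LieModule.toEnd_apply_apply, hv]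
  exact Pi.single_zero 0

/-- First variation at χ = 0, exact in degree 0: only the linear part of χ contributes. -/
theorem gaugeTransform_apply_zero {χ : FormalFun n 𝔤} (hχ : χ 0 = 0)
    (r : FormalFun n (𝔤 ⊗[ℂ] 𝔤)) :
    gaugeTransform b χ r 0 = r 0 - gaugeShift b χ 0 := by
  have h : EqMod (0 + 1) χ 0 := fun d hd => by
    rw [(Finsupp.degree_eq_zero_iff d).1 (by omega), hχ]; rfl
  have := gaugeTransform_eqMod b hχ h r 0 (by simp)
  rwa [gaugeTransform_zero, sub_zero] at this

/-- Improvement of a gauge transformation by one degree. -/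
theorem gaugeTransform_step (hP : ∀ x : 𝔩, P x = x) {χ : FormalFun n 𝔤} (hχ : χ 0 = 0)
    {r r' : FormalFun n (𝔤 ⊗[ℂ] 𝔤)} (hr : IsDynR b Ω (gaugeTransform b χ r))
    (hr' : IsDynR b Ω r') {k : ℕ} (h : EqMod (k + 1) (gaugeTransform b χ r) r') :
    EqMod (k + 2) (gaugeTransform b (χ + homotopy b P (gaugeTransform b χ r - r')) r) r' := by
  set R := gaugeTransform b χ r
  set f := R - r' with hf
  have hf0 : EqMod (k + 1) f 0 := by simpa using h.sub (EqMod.refl _ r')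
  have hh := homotopy_eqMod_zero b (P := P) hf0
  have hflip : mapVal (flip21 𝔤) f = -f := by
    have h1 := hr.quasiUnitary
    rw [← hr'.quasiUnitary] at h1
    rw [hf, mapVal_sub, eq_sub_of_add_eq' h1]
    abel
  -- Differentiation alone would give vanishing only below degree k. The equations replace Alt(df)
  -- by a difference of Yang–Baxter terms, which contain no derivative.
  have hclosed : EqMod (k + 1) (altD b f) 0 := by
    have h1 := hr.cdybe
    rw [← hr'.cdybe, CYBFun_eq, CYBFun_eq] at h1
    have h2 : altD b f = cprod (cybBil 𝔤) r' r' - cprod (cybBil 𝔤) R R := by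
      rw [hf, altD_sub, eq_sub_of_add_eq h1]
      abel
    rw [h2]
    simpa using (EqMod.refl _ (cprod (cybBil 𝔤) r' r')).sub (h.cprod (cybBil 𝔤) h)
  have hclosed' := hclosed.eulerContr b (P := P)
  rw [eulerContr_zero] at hclosed'
  have hmod : EqMod (k + 1 + 1) (χ + homotopy b P f) χ := by
    simpa using (EqMod.refl _ χ).add hh
  refine (gaugeTransform_eqMod b (by simp [hχ, homotopy_apply_zero]) hmod r).trans ?_
  rw [add_sub_cancel_left]
  intro d hd
  obtain ⟨h1, h2⟩ := gaugeShift_homotopy b hP hflip (hclosed' d hd)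
  -- The 𝔪⊗𝔪 obstruction vanishes: at the origin because f does, elsewhere because its multiple by
  -- |d| ≠ 0 vanishes.
  have h3 : TensorProduct.map (LinearMap.id - endProj P) (LinearMap.id - endProj P) (f d) = 0 := by
    by_cases h0 : d.degree = 0
    · rw [hf0 d (by omega), Pi.zero_apply, map_zero]
    · exact (smul_eq_zero.1 h2).resolve_left (Nat.cast_ne_zero.2 h0)
  rw [Pi.sub_apply, h1, h3, hf]
  simp [R]

/-- Two dynamical r-matrices with the same value at the origin are gauge equivalent. -/
theorem exists_gaugeTransform_eq [FiniteDimensional ℂ 𝔤] (hP : ∀ x : 𝔩, P x = x)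
    (hPe : ∀ (y : 𝔩) (a : 𝔤), P ⁅(y : 𝔤), a⁆ = ⁅y, P a⁆) (hΩ : ∀ x : 𝔤, ⁅x, Ω⁆ = 0)
    {r r' : FormalFun n (𝔤 ⊗[ℂ] 𝔤)} (hr : IsDynR b Ω r) (hr' : IsDynR b Ω r')
    (h0 : r 0 = r' 0) :
    ∃ χ : FormalFun n 𝔤, χ 0 = 0 ∧ IsEquivariant b χ ∧ r' = gaugeTransform b χ r := by
  -- One correction step; the k-th iterate from 0 achieves agreement through degree k.
  let T : FormalFun n 𝔤 → FormalFun n 𝔤 :=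
    fun χ => χ + homotopy b P (gaugeTransform b χ r - r')
  have hT (k : ℕ) : T^[k] 0 0 = 0 ∧ IsEquivariant b (T^[k] 0) ∧
      EqMod (k + 1) (gaugeTransform b (T^[k] 0) r) r' := by
    induction k with
    | zero =>
      refine ⟨rfl, ?_, fun d hd => ?_⟩
      · rw [isEquivariant_iff]
        intro y
        simp [mapVal_zero, lieD_zero]
      · rw [(Finsupp.degree_eq_zero_iff d).1 (by omega)]
        simpa [gaugeTransform_zero] using h0
    | succ k ih =>
      obtain ⟨h1, h2, h3⟩ := ih
      have h4 := hr.gaugeTransform b h1 h2 hΩ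
      rw [Function.iterate_succ_apply']
      refine ⟨by simp [T, h1, homotopy_apply_zero], h2.add b ?_,
        gaugeTransform_step b hP h1 h4 hr' h3⟩
      exact isEquivariant_homotopy b hPe (h4.equivariant.sub b hr'.equivariant)
  have hmod (k j : ℕ) : EqMod (k + 2) (T^[k + j] 0) (T^[k] 0) := by
    induction j with
    | zero => exact EqMod.refl _ _
    | succ j ih =>
      refine EqMod.trans ?_ ih
      rw [← add_assoc, Function.iterate_succ_apply']
      have h1 : EqMod (k + j + 1) (gaugeTransform b (T^[k + j] 0) r - r') 0 := by
        simpa using (hT (k + j)).2.2.sub (EqMod.refl _ r')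
      have h2 : EqMod (k + j + 2) (T (T^[k + j] 0)) (T^[k + j] 0) := by
        simpa using (EqMod.refl _ (T^[k + j] 0)).add (homotopy_eqMod_zero b (P := P) h1)
      exact h2.mono (by omega)
  -- By `hmod` the coefficients in degree |d| no longer change after step |d|, so this diagonal
  -- choice is the limit.
  let χ : FormalFun n 𝔤 := fun d => T^[d.degree] 0 d
  have hlim (k : ℕ) : EqMod (k + 1) χ (T^[k] 0) := fun d hd => by
    obtain ⟨j, hj⟩ := Nat.exists_eq_add_of_le (Nat.lt_succ_iff.1 hd)
    rw [hj]
    exact (hmod d.degree j d (by omega)).symm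
  have hχ : χ 0 = 0 := by
    rw [hlim 0 0 (by simp)]; rfl
  refine ⟨χ, hχ, isEquivariant_of_eqMod b fun m => ⟨_, (hT m).2.1, (hlim m).mono m.le_succ⟩, ?_⟩
  ext d
  -- One step beyond |d| is taken because the shift of the remainder loses a degree.
  have h1 := gaugeTransform_eqMod b hχ (hlim (d.degree + 1)) r
  have h2 : EqMod (d.degree + 1) (gaugeShift b (χ - T^[d.degree + 1] 0)) 0 := by
    have := ((hlim (d.degree + 1)).sub (EqMod.refl _ (T^[d.degree + 1] 0))).gaugeShift b
    rw [sub_self] at this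
    simpa [gaugeShift, dBar, pderiv_zero, mapVal_zero] using this
  rw [h1 d (by omega), Pi.sub_apply, h2 d (by omega), (hT (d.degree + 1)).2.2 d (by omega)]
  simp

end Convergence

/-! ### Normal form at the origin -/

section NormalForm

variable {𝔤 : Type*} [LieRing 𝔤] [LieAlgebra ℂ 𝔤] {𝔩 : LieSubalgebra ℂ 𝔤} {𝔪 : Submodule ℂ 𝔤}

/-- The projection to `𝔩` along an invariant complement. -/
def complProj (hcompl : IsCompl 𝔩.toSubmodule 𝔪) : 𝔤 →ₗ[ℂ] 𝔩 :=
  𝔩.toSubmodule.projectionOnto 𝔪 hcompl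

theorem complProj_coe (hcompl : IsCompl 𝔩.toSubmodule 𝔪) (x : 𝔩) : complProj hcompl x = x :=
  Submodule.projectionOnto_apply_left hcompl x

theorem endProj_complProj_coe (hcompl : IsCompl 𝔩.toSubmodule 𝔪) (x : 𝔩) :
    endProj (complProj hcompl) (x : 𝔤) = x :=
  congrArg Subtype.val (complProj_coe hcompl x)

theorem complProj_eq_zero_iff (hcompl : IsCompl 𝔩.toSubmodule 𝔪) {z : 𝔤} :
    complProj hcompl z = 0 ↔ z ∈ 𝔪 :=
  Submodule.projectionOnto_apply_eq_zero_iff hcompl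

theorem sub_complProj_mem (hcompl : IsCompl 𝔩.toSubmodule 𝔪) (a : 𝔤) :
    a - complProj hcompl a ∈ 𝔪 := by
  rw [← complProj_eq_zero_iff hcompl, map_sub, complProj_coe, sub_self]

theorem complProj_lie (hcompl : IsCompl 𝔩.toSubmodule 𝔪) (hinv : ∀ y ∈ 𝔩, ∀ z ∈ 𝔪, ⁅y, z⁆ ∈ 𝔪)
    (y : 𝔩) (a : 𝔤) : complProj hcompl ⁅(y : 𝔤), a⁆ = ⁅y, complProj hcompl a⁆ := by
  have h := (complProj_eq_zero_iff hcompl).2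
    (hinv y y.2 _ (sub_complProj_mem hcompl a))
  rw [lie_sub, map_sub, sub_eq_zero, ← LieSubalgebra.coe_bracket, complProj_coe] at h
  exact h

/-- The projection of `𝔤 ⊗ 𝔤` to `𝔪 ⊗ 𝔪`. -/
def tensorProj (hcompl : IsCompl 𝔩.toSubmodule 𝔪) : (𝔤 ⊗[ℂ] 𝔤) →ₗ[ℂ] (𝔤 ⊗[ℂ] 𝔤) :=
  TensorProduct.map (LinearMap.id - endProj (complProj hcompl))
    (LinearMap.id - endProj (complProj hcompl))

theorem tensorProj_mem_wedge2 (hcompl : IsCompl 𝔩.toSubmodule 𝔪) {v : 𝔤 ⊗[ℂ] 𝔤}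
    (hv : flip21 𝔤 v = -v) : tensorProj hcompl v ∈ wedge2 𝔪 := by
  constructor
  · let q : 𝔤 →ₗ[ℂ] 𝔪 := (LinearMap.id - endProj (complProj hcompl)).codRestrict 𝔪
      fun a => sub_complProj_mem hcompl a
    refine ⟨TensorProduct.map q q v, ?_⟩
    rw [← LinearMap.comp_apply, ← TensorProduct.map_comp]
    rfl
  · have : flip21 𝔤 (tensorProj hcompl v) = tensorProj hcompl (flip21 𝔤 v) :=
      (LinearMap.congr_fun (TensorProduct.map_comp_comm_eq _ _) v).symm
    simp [this, hv]

theorem tensorProj_eq_self (hcompl : IsCompl 𝔩.toSubmodule 𝔪) {v : 𝔤 ⊗[ℂ] 𝔤}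
    (hv : v ∈ wedge2 𝔪) : tensorProj hcompl v = v := by
  obtain ⟨⟨w, rfl⟩, -⟩ := hv
  rw [tensorProj, ← LinearMap.comp_apply, ← TensorProduct.map_comp]
  congr 2 <;>
  · ext z
    simp [endProj, (complProj_eq_zero_iff hcompl).2 z.2]

variable {n : ℕ} (b : Module.Basis (Fin n) ℂ 𝔩) {Ω : 𝔤 ⊗[ℂ] 𝔤}

/-- Every term has a tensor factor xᵢ in 𝔩. At the origin this makes the 𝔪⊗𝔪 component gauge
invariant. -/
theorem tensorProj_gaugeShift_apply (hcompl : IsCompl 𝔩.toSubmodule 𝔪) (χ : FormalFun n 𝔤) (d) :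
    tensorProj hcompl (gaugeShift b χ d) = 0 := by
  simp [tensorProj, gaugeShift, dBar, mapVal_apply, flip21, endProj_complProj_coe]

/-- The value at the origin of a dynamical r-matrix in normal form lies in `𝓜_Ω`. -/
theorem IsDynR.apply_zero_mem_MOmega (hΩ : ∀ x : 𝔤, ⁅x, Ω⁆ = 0)
    {r : FormalFun n (𝔤 ⊗[ℂ] 𝔤)} (hr : IsDynR b Ω r)
    (h : ∃ t ∈ wedge2 𝔪, r 0 = (1 / 2 : ℂ) • Ω + t) : r 0 ∈ MOmega 𝔩 𝔪 Ω := by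
  obtain ⟨t, ht, hrt⟩ := h
  refine ⟨⟨t, ht, fun y hy => ?_, hrt⟩, ?_⟩
  -- The vector fields of 𝔩 vanish at the origin, so r(0) is 𝔩-invariant, and with Ω also t.
  · have := congrFun ((isEquivariant_iff b).1 hr.equivariant ⟨y, hy⟩) 0
    rw [lieD_apply_zero, mapVal_apply, hrt] at this
    simpa [hΩ] using this
  · have h1 := congrFun hr.cdybe 0
    have h2 : CYBFun r 0 = CYB (r 0) := by
      simp [CYBFun, CYB, cprod_apply_zero]
    rw [Pi.add_apply, h2, Pi.zero_apply] at h1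
    rw [eq_neg_of_add_eq_zero_right h1, map_neg, neg_eq_zero]
    -- Each term of Alt(xᵢ ⊗ v) retains the factor xᵢ, which dies in 𝔤/𝔩.
    have key (i : Fin n) (v : 𝔤 ⊗[ℂ] 𝔤) : TensorProduct.map 𝔩.toSubmodule.mkQ
        (TensorProduct.map 𝔩.toSubmodule.mkQ 𝔩.toSubmodule.mkQ)
          (Alt 𝔤 ((b i : 𝔤) ⊗ₜ v)) = 0 := by
      have hb : 𝔩.toSubmodule.mkQ (b i : 𝔤) = 0 := by
        rw [Submodule.mkQ_apply, Submodule.Quotient.mk_eq_zero]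
        exact (b i).2
      induction v with
      | zero => simp
      | add v w hv hw => rw [TensorProduct.tmul_add, map_add, map_add, hv, hw, add_zero]
      | tmul a c =>
        simp only [Alt_tmul, map_add, map_sub, TensorProduct.map_tmul, hb]
        simp
    simp [altD, mapVal_apply, key]

/-- Every dynamical r-matrix is gauge equivalent to one in normal form. -/
theorem exists_gaugeTransform_normal [FiniteDimensional ℂ 𝔤] (hcompl : IsCompl 𝔩.toSubmodule 𝔪)
    (hinv : ∀ y ∈ 𝔩, ∀ z ∈ 𝔪, ⁅y, z⁆ ∈ 𝔪) (hsymm : flip21 𝔤 Ω = Ω) (hΩ : ∀ x : 𝔤, ⁅x, Ω⁆ = 0)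
    {r : FormalFun n (𝔤 ⊗[ℂ] 𝔤)} (hr : IsDynR b Ω r) :
    ∃ χ : FormalFun n 𝔤, χ 0 = 0 ∧ IsEquivariant b χ ∧
      ∃ t ∈ wedge2 𝔪, gaugeTransform b χ r 0 = (1 / 2 : ℂ) • Ω + t := by
  set f := r - const n ((1 / 2 : ℂ) • Ω) with hf
  have hflip : mapVal (flip21 𝔤) f = -f := by
    have h1 : const n Ω = const n ((1 / 2 : ℂ) • Ω) + const n ((1 / 2 : ℂ) • Ω) := by
      rw [const, const, ← Pi.single_add, ← add_smul]
      norm_num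
    have h2 := hr.quasiUnitary
    rw [hf, mapVal_sub, mapVal_const, map_smul, hsymm, eq_sub_of_add_eq' h2, h1]
    abel
  have hχ := homotopy_apply_zero b (P := complProj hcompl) f
  refine ⟨homotopy b (complProj hcompl) f, hχ,
    isEquivariant_homotopy b (complProj_lie hcompl hinv) (hr.equivariant.sub b
      (isEquivariant_const b fun y => by simp [hΩ])),
    tensorProj hcompl (f 0), tensorProj_mem_wedge2 hcompl (congrFun hflip 0), ?_⟩
  -- The Euler contraction of Alt(df) vanishes at the origin for any f, so r - Ω/2 need not be
  -- closed here.
  rw [gaugeTransform_apply_zero b hχ, (gaugeShift_homotopy b (complProj_coe hcompl) hflip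
    (by simp [eulerContr, mulLin_apply_zero])).1]
  simp only [hf, tensorProj, const, Pi.sub_apply, Pi.single_eq_same]
  abel

end NormalForm

end DynR

end

/-! ### The map on gauge classes -/

open DynR in
theorem corollary3p1 {𝔤 : Type*} [LieRing 𝔤] [LieAlgebra ℂ 𝔤] [FiniteDimensional ℂ 𝔤]
    (𝔩 : LieSubalgebra ℂ 𝔤) {n : ℕ} (b : Module.Basis (Fin n) ℂ 𝔩)
    (𝔪 : Submodule ℂ 𝔤) (hcompl : IsCompl 𝔩.toSubmodule 𝔪)
    (hinv : ∀ y ∈ 𝔩, ∀ z ∈ 𝔪, ⁅y, z⁆ ∈ 𝔪)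
    (Ω : 𝔤 ⊗[ℂ] 𝔤) (hsymm : TensorProduct.comm ℂ 𝔤 𝔤 Ω = Ω) (hΩ : ∀ x : 𝔤, ⁅x, Ω⁆ = 0) :
    -- every class has a representative `r` with `r(0) ∈ Ω/2 + Λ²𝔪`
    (∀ C : Moduli b Ω, ∃ r : Dynr b Ω,
      gaugeClass b r = C ∧ ∃ t ∈ wedge2 𝔪, r.1 0 = (1 / 2 : ℂ) • Ω + t) ∧
    -- sending the class of each such `r` to `r(0)` is a well-defined injective map to `𝓜_Ω`
    ∃ Φ : Moduli b Ω → MOmega 𝔩 𝔪 Ω,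
      (∀ r : Dynr b Ω, (∃ t ∈ wedge2 𝔪, r.1 0 = (1 / 2 : ℂ) • Ω + t) →
        (Φ (gaugeClass b r) : 𝔤 ⊗[ℂ] 𝔤) = r.1 0) ∧
      Function.Injective Φ := by
  have hrep : ∀ C : Moduli b Ω, ∃ r : Dynr b Ω,
      gaugeClass b r = C ∧ ∃ t ∈ wedge2 𝔪, r.1 0 = (1 / 2 : ℂ) • Ω + t := by
    rintro ⟨r⟩
    obtain ⟨χ, hχ, he, ht⟩ := exists_gaugeTransform_normal b hcompl hinv hsymm hΩ r.2
    exact ⟨⟨gaugeTransform b χ r.1, r.2.gaugeTransform b hχ he hΩ⟩,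
      (Quot.sound ⟨χ, hχ, he, rfl⟩).symm, ht⟩
  -- Projecting r(0) - Ω/2 to 𝔪⊗𝔪 is defined for every representative and is gauge invariant; on
  -- normal forms it returns r(0), so no choice of representative enters.
  let Ψ : Moduli b Ω → 𝔤 ⊗[ℂ] 𝔤 :=
    Quot.lift (fun r => (1 / 2 : ℂ) • Ω + tensorProj hcompl (r.1 0 - (1 / 2 : ℂ) • Ω))
      fun r r' ⟨χ, hχ, _, h⟩ => by
        rw [h, gaugeTransform_apply_zero b hχ, sub_right_comm, map_sub (tensorProj hcompl) (_ - _),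
          tensorProj_gaugeShift_apply, sub_zero]
  have hΨ (r : Dynr b Ω) (hr : ∃ t ∈ wedge2 𝔪, r.1 0 = (1 / 2 : ℂ) • Ω + t) :
      Ψ (gaugeClass b r) = r.1 0 := by
    obtain ⟨t, ht, hrt⟩ := hr
    change (1 / 2 : ℂ) • Ω + tensorProj hcompl (r.1 0 - (1 / 2 : ℂ) • Ω) = r.1 0
    rw [hrt, add_sub_cancel_left, tensorProj_eq_self hcompl ht]
  have hmem (C : Moduli b Ω) : Ψ C ∈ MOmega 𝔩 𝔪 Ω := by
    obtain ⟨r, rfl, hr⟩ := hrep C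
    rw [hΨ r hr]
    exact r.2.apply_zero_mem_MOmega b hΩ hr
  refine ⟨hrep, fun C => ⟨Ψ C, hmem C⟩, hΨ, fun C C' hC => ?_⟩
  obtain ⟨r, rfl, hr⟩ := hrep C
  obtain ⟨r', rfl, hr'⟩ := hrep C'
  have h0 : Ψ (gaugeClass b r) = Ψ (gaugeClass b r') := congrArg Subtype.val hC
  rw [hΨ r hr, hΨ r' hr'] at h0
  exact Quot.sound (exists_gaugeTransform_eq b (complProj_coe hcompl)
    (complProj_lie hcompl hinv) hΩ r.2 r'.2 h0)
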